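/- Let $I\neq\emptyset$ be an at most countable alphabet with the discrete topology, let $A\colon I\times I\to\{0,1\}$, and let $E^\infty=\{\omega\in I^{\mathbb N}: A_{\omega_j\omega_{j+1}}=1\ \forall j\ge 1\}$ carry the subspace topology of the product topology, with shift map $\sigma$. Let $E^n$ be the set of subwords of length $n$ of elements of $E^\infty$, let $E^*$ be the union of the $E^n$ together with the empty word, and for $\omega\in E^n$ let $[\omega]\subset E^\infty$ be the set of sequences with initial subword $\omega$. Assume that $A$ is finitely irreducible: there is a finite set $\Lambda\subset E^*$ such that for all $i,j\in I$ there is $\omega\in\Lambda$ with $i\omega j\in E^*$. Let $\theta\in(0,1)$ and let $f=u+\mathbf i v\colon E^\infty\to\mathbb C$ ($u,v$ real-valued) be $\theta$-Hölder continuous, i.e. $f$ is continuous and $\sup_{n\ge1}\theta^{-n}\sup\{|f(x)-f(y)| : x_i=y_i\text{ for }i\le n\}<\infty$ ($f$ may be unbounded). Suppose that $u$ is summable, i.e. $\sum_{e\in I}\exp(\sup u|_{[e]})<\infty$. Let $\mathcal L_f$ be the Perron–Frobenius operator on the space $\mathcal C_b(E^\infty)$ of bounded continuous complex-valued functions, $$\mathcal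 L_f(g)(\omega)=\sum_{e\in I:\,A_{e\omega_1}=1}e^{f(e\omega)}g(e\omega).$$ Then the topological pressure $$P(u)=\lim_{n\to\infty}\frac1n\log\sum_{\omega\in E^n}\exp\Big(\sup_{\tau\in[\omega]}\sum_{j=0}^{n-1}u(\sigma^j\tau)\Big)$$ exists and is a real number, and for every $a\in[0,2\pi)$ the following are equivalent: (i) $e^{\mathbf i a+P(u)}$ is an eigenvalue of $\mathcal L_f$ on $\mathcal C_b(E^\infty)$; (ii) there is a continuous $\zeta\colon E^\infty\to\mathbb R$ such that $v-a+\zeta\circ\sigma-\zeta$ takes values only in $2\pi\mathbb Z$. (A function $f$ satisfying one, hence both, of these conditions is called an $a$-function.) -/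

import Mathlib

open Filter Topology
open scoped ENNReal BoundedContinuousFunction

namespace MarkovShift

noncomputable section

/-- The space of `A`-admissible infinite sequences over the alphabet `α` (positions counted from
`0`), for a `0`-`1` incidence matrix `A`, with the subspace topology of the product topology on
`ℕ → α`. -/
abbrev ShiftSpace {α : Type*} (A : α → α → Bool) : Type _ :=
  {x : ℕ → α // ∀ j : ℕ, A (x j) (x (j + 1)) = true}

/-- The shift map. -/
def shift {α : Type*} {A : α → α → Bool} (x : ShiftSpace A) : ShiftSpace A :=
  ⟨fun j => x.1 (j + 1), fun j => x.2 (j + 1)⟩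

/-- The sequence `e x` obtained by putting the letter `e` in front of `x`. -/
def cons {α : Type*} {A : α → α → Bool} (e : α) (x : ShiftSpace A) (h : A e (x.1 0) = true) :
    ShiftSpace A :=
  ⟨fun j => Nat.casesOn j e x.1, fun j => Nat.casesOn j h x.2⟩

/-- A finite word is admissible if it is empty or a subword of an admissible infinite sequence. -/
def IsAdmissibleWord {α : Type*} (A : α → α → Bool) (w : List α) : Prop :=
  w = [] ∨ ∃ (x : ShiftSpace A) (k : ℕ), ∀ (i : ℕ) (hi : i < w.length), w[i] = x.1 (k + i)

/-- The admissible words of length `n`. -/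
def words {α : Type*} (A : α → α → Bool) (n : ℕ) : Set (List α) :=
  {w | w.length = n ∧ IsAdmissibleWord A w}

/-- Finite irreducibility of the incidence matrix. -/
def FinitelyIrreducible {α : Type*} (A : α → α → Bool) : Prop :=
  ∃ Λ : Set (List α), Λ.Finite ∧ (∀ w ∈ Λ, IsAdmissibleWord A w) ∧
    ∀ i j : α, ∃ w ∈ Λ, IsAdmissibleWord A (i :: (w ++ [j]))

/-- The cylinder set of a finite word. -/
def cylinder {α : Type*} (A : α → α → Bool) (w : List α) : Set (ShiftSpace A) :=
  {x | ∀ (i : ℕ) (hi : i < w.length), x.1 i = w[i]}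

/-- The `n`-th variation of `f`, an element of `[0, ∞]`. -/
def variation {α : Type*} {A : α → α → Bool} (n : ℕ) (f : ShiftSpace A → ℂ) : ℝ≥0∞ :=
  ⨆ (x : ShiftSpace A) (y : ShiftSpace A) (_ : ∀ i < n, x.1 i = y.1 i), ENNReal.ofReal ‖f x - f y‖

/-- The Hölder seminorm `sup_{n ≥ 1} var_n(f) / θ ^ n`, an element of `[0, ∞]`. -/
def holderNorm {α : Type*} {A : α → α → Bool} (θ : ℝ) (f : ShiftSpace A → ℂ) : ℝ≥0∞ :=
  ⨆ (n : ℕ) (_ : 1 ≤ n), variation n f / ENNReal.ofReal (θ ^ n)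

/-- `θ`-Hölder continuous functions (not necessarily bounded). -/
structure IsHolder {α : Type*} [TopologicalSpace α] {A : α → α → Bool} (θ : ℝ)
    (f : ShiftSpace A → ℂ) : Prop where
  continuous : Continuous f
  holderNorm_lt_top : holderNorm θ f < ∞

/-- Birkhoff sums. -/
def birkhoff {α : Type*} {A : α → α → Bool} (n : ℕ) (u : ShiftSpace A → ℝ) (x : ShiftSpace A) : ℝ :=
  ∑ j ∈ Finset.range n, u (shift^[j] x)

/-- `∑_{w} exp (sup_{[w]} S_n u)`, the sum over the admissible words of length `n`,
as an element of `[0, ∞]`. -/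
def partitionSum {α : Type*} {A : α → α → Bool} (u : ShiftSpace A → ℝ) (n : ℕ) : ℝ≥0∞ :=
  ∑' w : words A n, EReal.exp (⨆ x ∈ cylinder A w.1, (birkhoff n u x : EReal))

/-- The topological pressure of `u` exists as a limit and is the real number `P`. -/
def HasPressure {α : Type*} {A : α → α → Bool} (u : ShiftSpace A → ℝ) (P : ℝ) : Prop :=
  Tendsto (fun n : ℕ => ENNReal.log (partitionSum u n) / (n : EReal)) atTop (𝓝 (P : EReal))

/-- Summability: `∑_e exp (sup_{[e]} u) < ∞`. -/
def IsSummable {α : Type*} {A : α → α → Bool} (u : ShiftSpace A → ℝ) : Prop :=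
  ∑' e : α, EReal.exp (⨆ x ∈ cylinder A [e], (u x : EReal)) < ∞

/-- The `e`-th term of the Perron-Frobenius sum at `ω`; it is `0` if `e ω` is not admissible. -/
def transferTerm {α : Type*} {A : α → α → Bool} (f g : ShiftSpace A → ℂ) (e : α)
    (ω : ShiftSpace A) : ℂ :=
  if h : A e (ω.1 0) = true then Complex.exp (f (cons e ω h)) * g (cons e ω h) else 0

theorem continuous_transferTerm {α : Type*} [TopologicalSpace α] [DiscreteTopology α]
    {A : α → α → Bool} {f g : ShiftSpace A → ℂ} (hf : Continuous f) (hg : Continuous g) (e : α) :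
    Continuous (transferTerm f g e) := by
  have h0 : Continuous (fun ω : ShiftSpace A => A e (ω.1 0)) :=
    (continuous_of_discreteTopology (f := fun b : α => A e b)).comp
      ((continuous_apply 0).comp continuous_subtype_val)
  have hU : IsOpen {ω : ShiftSpace A | A e (ω.1 0) = true} :=
    (isOpen_discrete {true}).preimage h0
  have hV : IsOpen {ω : ShiftSpace A | A e (ω.1 0) = false} :=
    (isOpen_discrete {false}).preimage h0
  rw [continuous_iff_continuousAt]
  intro ω
  by_cases h : A e (ω.1 0) = true
  · refine ContinuousOn.continuousAt (s := {ω : ShiftSpace A | A e (ω.1 0) = true}) ?_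
      (hU.mem_nhds h)
    rw [continuousOn_iff_continuous_domRestrict]
    have hc : Continuous (fun ω : {ω : ShiftSpace A | A e (ω.1 0) = true} =>
        cons e ω.1 ω.2) := by
      refine Continuous.subtype_mk (continuous_pi fun j => ?_) _
      cases j with
      | zero => exact continuous_const
      | succ j =>
        exact (continuous_apply j).comp (continuous_subtype_val.comp continuous_subtype_val)
    have heq : Set.domRestrict {ω : ShiftSpace A | A e (ω.1 0) = true} (transferTerm f g e)
        = fun ω => Complex.exp (f (cons e ω.1 ω.2)) * g (cons e ω.1 ω.2) := by
      funext ω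
      have hω : A e (ω.1.1 0) = true := ω.2
      change transferTerm f g e ω.1 = _
      simp [transferTerm, hω]
    rw [heq]
    exact (Complex.continuous_exp.comp (hf.comp hc)).mul (hg.comp hc)
  · have h' : A e (ω.1 0) = false := by simpa using h
    refine (continuousAt_const (y := (0 : ℂ))).congr ?_
    filter_upwards [hV.mem_nhds h'] with x hx
    have hx' : A e (x.1 0) = false := hx
    simp [transferTerm, hx']

/-- The weight `exp (sup_{[e]} u)` as a real number. -/
def letterWeight {α : Type*} {A : α → α → Bool} (u : ShiftSpace A → ℝ) (e : α) : ℝ :=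
  (EReal.exp (⨆ x ∈ cylinder A [e], (u x : EReal))).toReal

theorem summable_letterWeight {α : Type*} {A : α → α → Bool} {u : ShiftSpace A → ℝ}
    (hu : IsSummable u) : Summable (letterWeight u) :=
  ENNReal.summable_toReal hu.ne

theorem norm_transferTerm_le {α : Type*} {A : α → α → Bool} {f g : ShiftSpace A → ℂ} {C : ℝ}
    (hu : IsSummable (fun x => (f x).re)) (hg : ∀ x, ‖g x‖ ≤ C) (e : α) (ω : ShiftSpace A) :
    ‖transferTerm f g e ω‖ ≤ letterWeight (fun x => (f x).re) e * C := by
  have hC : 0 ≤ C := (norm_nonneg _).trans (hg ω)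
  unfold transferTerm
  split_ifs with h
  · rw [norm_mul, Complex.norm_exp]
    refine mul_le_mul ?_ (hg _) (norm_nonneg _) ENNReal.toReal_nonneg
    have hmem : cons e ω h ∈ cylinder A [e] := by
      intro i hi
      have hi0 : i = 0 := by simpa using hi
      subst hi0
      rfl
    have hle : ((f (cons e ω h)).re : EReal) ≤ ⨆ x ∈ cylinder A [e], ((f x).re : EReal) :=
      le_iSup₂ (f := fun x (_ : x ∈ cylinder A [e]) => ((f x).re : EReal)) _ hmem
    have h2 := ENNReal.toReal_mono (ENNReal.ne_top_of_tsum_ne_top hu.ne e) (EReal.exp_monotone hle)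
    rwa [EReal.exp_coe, ENNReal.toReal_ofReal (Real.exp_pos _).le] at h2
  · rw [norm_zero]
    exact mul_nonneg ENNReal.toReal_nonneg hC

theorem summable_transferTerm {α : Type*} {A : α → α → Bool} {f g : ShiftSpace A → ℂ} {C : ℝ}
    (hu : IsSummable (fun x => (f x).re)) (hg : ∀ x, ‖g x‖ ≤ C) (ω : ShiftSpace A) :
    Summable (fun e => transferTerm f g e ω) :=
  Summable.of_norm_bounded ((summable_letterWeight hu).mul_right C)
    (fun e => norm_transferTerm_le hu hg e ω)

theorem norm_tsum_transferTerm_le {α : Type*} {A : α → α → Bool} {f g : ShiftSpace A → ℂ} {C : ℝ}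
    (hu : IsSummable (fun x => (f x).re)) (hg : ∀ x, ‖g x‖ ≤ C) (ω : ShiftSpace A) :
    ‖∑' e, transferTerm f g e ω‖ ≤ (∑' e, letterWeight (fun x => (f x).re) e) * C := by
  rw [← tsum_mul_right]
  exact tsum_of_norm_bounded ((summable_letterWeight hu).mul_right C).hasSum
    (fun e => norm_transferTerm_le hu hg e ω)

/-- The Perron-Frobenius operator
`(L_f g)(ω) = ∑_{e : A e ω₁ = 1} exp (f (e ω)) * g (e ω)`
on the bounded continuous complex-valued functions. -/
def transferOperator {α : Type*} [TopologicalSpace α] [DiscreteTopology α] {A : α → α → Bool}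
    (f : ShiftSpace A → ℂ) (hf : Continuous f) (hu : IsSummable (fun x => (f x).re)) :
    (ShiftSpace A →ᵇ ℂ) →L[ℂ] (ShiftSpace A →ᵇ ℂ) :=
  LinearMap.mkContinuous
    { toFun := fun g => BoundedContinuousFunction.ofNormedAddCommGroup
        (fun ω => ∑' e, transferTerm f g e ω)
        (continuous_tsum (fun e => continuous_transferTerm hf g.continuous e)
          ((summable_letterWeight hu).mul_right ‖g‖)
          (fun e ω => norm_transferTerm_le hu g.norm_coe_le_norm e ω))
        ((∑' e, letterWeight (fun x => (f x).re) e) * ‖g‖)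
        (norm_tsum_transferTerm_le hu g.norm_coe_le_norm)
      map_add' := fun g k => by
        ext ω
        change ∑' e, transferTerm f (g + k) e ω
          = ∑' e, transferTerm f g e ω + ∑' e, transferTerm f k e ω
        rw [← (summable_transferTerm hu g.norm_coe_le_norm ω).tsum_add
          (summable_transferTerm hu k.norm_coe_le_norm ω)]
        refine tsum_congr fun e => ?_
        unfold transferTerm
        split_ifs <;> simp [mul_add]
      map_smul' := fun c g => by
        ext ω
        change ∑' e, transferTerm f (c • g) e ω = c * ∑' e, transferTerm f g e ω
        rw [← tsum_mul_left]
        refine tsum_congr fun e => ?_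
        unfold transferTerm
        split_ifs <;> simp [mul_left_comm] }
    (∑' e, letterWeight (fun x => (f x).re) e)
    (fun g => by
      refine (BoundedContinuousFunction.norm_le (mul_nonneg
        (tsum_nonneg fun e => ENNReal.toReal_nonneg) (norm_nonneg g))).2 ?_
      exact norm_tsum_transferTerm_le hu g.norm_coe_le_norm)

end

end MarkovShift

/-!
The whole proof takes place on the transfer operator `φ ↦ ∑_{σ y = x} exp (u y) φ y`, `u = Re f`,
acting on arbitrary `[0, ∞]`-valued functions (`transferIter`); no conformal measure is needed.

*Uniform bounds.* The Birkhoff sums of two points that agree on `n` letters differ by a bounded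
amount (`HasVariationBound.birkhoff_le`), and by finite irreducibility any prefix can be continued
to any point through a connecting word of bounded length and bounded cost (`exists_connection`).
Hence the `n`-th partition sum and the value of the `n`-th iterate of `1` at any single point are
comparable, uniformly in `n` and the point (`exists_partitionSum_le`). So the partition sums are
multiplicative up to a constant; Fekete's lemma gives a finite pressure `P`, and the iterates of `1`
for the normalised potential `u - P` lie between two positive constants (`exists_hasPressure`).

*From the cohomological equation to an eigenfunction.* The Cesàro means of these iterates have
uniformly controlled oscillation on cylinders. Their limit along an ultrafilter is a continuous
eigenfunction `h` of the normalised operator, bounded and bounded away from `0`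
(`exists_eigenfunction`), and `h * exp (-i ζ)` is the required eigenfunction of `L_f`
(`hasEigenvalue_of_cohomologous`).

*From an eigenfunction to the cohomological equation.* If `L_f g = exp (i a + P) g`, then `w = |g|`
is at most its image `T w` under the normalised operator `T`. If the inequality were strict
somewhere, it would be so by a fixed amount on a cylinder; irreducibility spreads this gain to all
points, so some power `S` of `T` satisfies `S w ≥ w + c` with `c > 0`. Since the iterates of `1` are
bounded below, iterating makes `S ^ j w` grow linearly in `j`, whereas it is bounded
(`eq_zero_of_add_le_transferIter`). So `T w = w`, which forces `w > 0` everywhere and equality in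
the triangle inequality for `L_f g` at every point (`norm_eigenfunction`). Therefore all terms
`exp (f y) g y` with `σ y = x` point in the direction of `exp (i a) g x`, and a continuous argument
of `g`, which exists because cylinders are open and closed (`exists_continuous_arg`), is the
negative of a solution `ζ` of the cohomological equation (`exists_cohomologous_of_eigenfunction`).
-/

namespace MarkovShift

noncomputable section

/-! ### Sequences, glueing and distortion -/

theorem shift_iterate_apply {α : Type*} {A : α → α → Bool} (n : ℕ) (x : ShiftSpace A) (j : ℕ) :
    (shift^[n] x).1 j = x.1 (j + n) := by
  induction n generalizing x with
  | zero => rfl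
  | succ n ih => rw [Function.iterate_succ_apply, ih]; rfl

/-- The sequence that follows `z` for the first `n` letters and `y` from then on. It is admissible
because `y` starts with the letter that `z` has at position `n`. -/
def glue {α : Type*} {A : α → α → Bool} (n : ℕ) (z y : ShiftSpace A) (h : z.1 n = y.1 0) :
    ShiftSpace A :=
  ⟨fun j => if j < n then z.1 j else y.1 (j - n), fun j => by
    beta_reduce
    rcases lt_trichotomy (j + 1) n with hj | hj | hj
    · rw [if_pos (by omega), if_pos hj]
      exact z.2 j
    · subst hj
      rw [if_pos (by omega), if_neg (by omega), Nat.sub_self, ← h]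
      exact z.2 j
    · rw [if_neg (by omega), if_neg (by omega), Nat.sub_add_comm (Nat.lt_succ_iff.1 hj)]
      exact y.2 _⟩

theorem glue_apply_of_lt {α : Type*} {A : α → α → Bool} {n : ℕ} {z y : ShiftSpace A}
    (h : z.1 n = y.1 0) {j : ℕ} (hj : j < n) : (glue n z y h).1 j = z.1 j :=
  if_pos hj

theorem glue_apply_add {α : Type*} {A : α → α → Bool} {n : ℕ} {z y : ShiftSpace A}
    (h : z.1 n = y.1 0) (j : ℕ) : (glue n z y h).1 (j + n) = y.1 j := by
  change (if j + n < n then z.1 (j + n) else y.1 (j + n - n)) = _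
  rw [if_neg (by omega), Nat.add_sub_cancel]

theorem shift_iterate_glue {α : Type*} {A : α → α → Bool} {n : ℕ} {z y : ShiftSpace A}
    (h : z.1 n = y.1 0) : shift^[n] (glue n z y h) = y := by
  refine Subtype.ext (funext fun j => ?_)
  rw [shift_iterate_apply, glue_apply_add]

/-- A point is determined by its first `n` letters and its image under the `n`-th iterate of the
shift. -/
theorem eq_of_prefix_of_shift_iterate {α : Type*} {A : α → α → Bool} {n : ℕ} {y z : ShiftSpace A}
    (h : ∀ i < n, y.1 i = z.1 i) (hs : shift^[n] y = shift^[n] z) : y = z := by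
  refine Subtype.ext (funext fun j => ?_)
  rcases lt_or_ge j n with hj | hj
  · exact h j hj
  · have := congrArg (fun x : ShiftSpace A => x.1 (j - n)) hs
    simpa only [shift_iterate_apply, Nat.sub_add_cancel hj] using this

theorem injective_first_letter {α : Type*} {A : α → α → Bool} (x : ShiftSpace A) :
    Function.Injective fun y : {y : ShiftSpace A // shift y = x} => y.1.1 0 := by
  intro y z h
  refine Subtype.ext (eq_of_prefix_of_shift_iterate (n := 1) (fun i hi => ?_)
    (y.2.trans z.2.symm))
  rw [Nat.lt_one_iff.1 hi]
  exact h

theorem birkhoff_add {α : Type*} {A : α → α → Bool} (m n : ℕ) (u : ShiftSpace A → ℝ)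
    (x : ShiftSpace A) :
    birkhoff (m + n) u x = birkhoff m u x + birkhoff n u (shift^[m] x) := by
  unfold birkhoff
  rw [Finset.sum_range_add]
  congr 1
  refine Finset.sum_congr rfl fun j _ => ?_
  rw [add_comm m j, Function.iterate_add_apply]

theorem birkhoff_one {α : Type*} {A : α → α → Bool} (u : ShiftSpace A → ℝ) (x : ShiftSpace A) :
    birkhoff 1 u x = u x := by
  simp [birkhoff]

/-- The oscillation of `u` on cylinders of length `n ≥ 1` is at most `V * θ ^ n`. -/
def HasVariationBound {α : Type*} {A : α → α → Bool} (θ V : ℝ) (u : ShiftSpace A → ℝ) : Prop :=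
  ∀ n : ℕ, 1 ≤ n → ∀ x y : ShiftSpace A, (∀ i < n, x.1 i = y.1 i) → u x - u y ≤ V * θ ^ n

/-- Bounded distortion: along `n` steps the Birkhoff sums of two points that agree on `n + m`
letters stay close, by comparison with a geometric series. -/
theorem HasVariationBound.birkhoff_le {α : Type*} {A : α → α → Bool} {θ V : ℝ}
    {u : ShiftSpace A → ℝ} (hu : HasVariationBound θ V u) (hθ0 : 0 < θ) (hθ1 : θ < 1) (hV : 0 ≤ V)
    (n m : ℕ) {x y : ShiftSpace A} (h : ∀ i < n + m, x.1 i = y.1 i) :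
    birkhoff n u x ≤ birkhoff n u y + V / (1 - θ) * θ ^ m := by
  have key : (birkhoff n u x - birkhoff n u y) * (1 - θ) ≤ V * θ ^ (m + 1) * (1 - θ ^ n) := by
    induction n generalizing x y with
    | zero => simp [birkhoff]
    | succ n ih =>
      have h1 := hu (n + 1 + m) (by omega) x y h
      have h2 := ih (x := shift x) (y := shift y) fun i hi => h (i + 1) (by omega)
      have h3 : ∀ x : ShiftSpace A, birkhoff (n + 1) u x = u x + birkhoff n u (shift x) := by
        intro x
        rw [add_comm n 1, birkhoff_add, birkhoff_one]
        rfl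
      rw [h3 x, h3 y]
      have h4 := mul_le_mul_of_nonneg_right h1 (sub_nonneg.2 hθ1.le)
      calc _ = (u x - u y) * (1 - θ)
            + (birkhoff n u (shift x) - birkhoff n u (shift y)) * (1 - θ) := by ring
        _ ≤ V * θ ^ (n + 1 + m) * (1 - θ) + V * θ ^ (m + 1) * (1 - θ ^ n) := add_le_add h4 h2
        _ = _ := by ring
  have hθ : 0 < 1 - θ := sub_pos.2 hθ1
  have h5 : V * θ ^ (m + 1) * (1 - θ ^ n) ≤ V * θ ^ m := by
    have h6 : θ ^ (m + 1) ≤ θ ^ m := pow_le_pow_of_le_one hθ0.le hθ1.le (Nat.le_succ m)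
    have h7 : 1 - θ ^ n ≤ 1 := by linarith [pow_pos hθ0 n]
    calc V * θ ^ (m + 1) * (1 - θ ^ n) ≤ V * θ ^ (m + 1) * 1 := by gcongr
      _ ≤ V * θ ^ m := by rw [mul_one]; gcongr
  have h8 : birkhoff n u x - birkhoff n u y ≤ V * θ ^ m / (1 - θ) := by
    rw [le_div_iff₀ hθ]
    exact key.trans h5
  have h9 : V / (1 - θ) * θ ^ m = V * θ ^ m / (1 - θ) := by ring
  linarith

/-- Finite irreducibility, in terms of points: every prefix can be continued to every point
through a connecting word of bounded length, along which the Birkhoff sum is bounded below. -/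
theorem exists_connection {α : Type*} {A : α → α → Bool} {θ V : ℝ} {u : ShiftSpace A → ℝ}
    (hA : FinitelyIrreducible A) (hu : HasVariationBound θ V u) (hθ0 : 0 < θ) (hθ1 : θ < 1)
    (hV : 0 ≤ V) :
    ∃ (N : ℕ) (c : ℝ), ∀ (y x : ShiftSpace A) (n : ℕ), ∃ k ≤ N, ∃ z : ShiftSpace A,
      (∀ i < n, z.1 i = y.1 i) ∧ shift^[n + k] z = x ∧ -c ≤ birkhoff k u (shift^[n] z) := by
  obtain ⟨Λ, hΛ, -, hconn⟩ := hA
  have hw : ∀ w : List α, ∃ c : ℝ, ∀ z ∈ cylinder A w, -c ≤ birkhoff w.length u z := by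
    intro w
    rcases (cylinder A w).eq_empty_or_nonempty with h | ⟨r, hr⟩
    · exact ⟨0, fun z hz => by simp [h] at hz⟩
    · refine ⟨V / (1 - θ) - birkhoff w.length u r, fun z hz => ?_⟩
      have := hu.birkhoff_le hθ0 hθ1 hV w.length 0 (x := r) (y := z)
        fun i hi => (hr i hi).trans (hz i hi).symm
      rw [pow_zero, mul_one] at this
      linarith
  choose c hc using hw
  obtain ⟨c0, hc0⟩ := (hΛ.image c).bddAbove
  obtain ⟨N, hN⟩ := (hΛ.image List.length).bddAbove
  refine ⟨N, max c0 0, fun y x n => ?_⟩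
  rcases n with _ | m
  · refine ⟨0, Nat.zero_le _, x, fun i hi => absurd hi (Nat.not_lt_zero i), rfl, ?_⟩
    simp [birkhoff]
  obtain ⟨w, hwΛ, hadm⟩ := hconn (y.1 m) (x.1 0)
  obtain hnil | ⟨p, k, hp⟩ := hadm
  · simp at hnil
  have hp0 : (shift^[k] p).1 0 = y.1 m := by
    have := hp 0 (by simp)
    rw [shift_iterate_apply, zero_add]
    simpa using this.symm
  have hpi : ∀ (i : ℕ) (hi : i < w.length), (shift^[k] p).1 (i + 1) = w[i] := by
    intro i hi
    have := hp (i + 1) (by simp; omega)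
    rw [List.getElem_cons_succ, List.getElem_append_left hi] at this
    rw [shift_iterate_apply, this, add_comm]
  have hpl : (shift^[k] p).1 (w.length + 1) = x.1 0 := by
    have := hp (w.length + 1) (by simp)
    rw [List.getElem_cons_succ, List.getElem_append_right le_rfl] at this
    rw [shift_iterate_apply, add_comm, ← this]
    simp
  -- Glue `y`, up to its last prescribed letter, to the realisation of the connecting word and then
  -- to `x`.
  have hq0 : y.1 m = (glue (w.length + 1) (shift^[k] p) x hpl).1 0 := by
    rw [glue_apply_of_lt _ (Nat.succ_pos _), hp0]
  set q := glue (w.length + 1) (shift^[k] p) x hpl with hq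
  have hz := shift_iterate_glue hq0
  set z := glue m y q hq0 with hzdef
  have hs1 : shift^[m + 1] z = shift q := by rw [Function.iterate_succ_apply', hz]
  refine ⟨w.length, hN ⟨w, hwΛ, rfl⟩, z, fun i hi => ?_, ?_, ?_⟩
  · rcases Nat.lt_succ_iff_lt_or_eq.1 hi with h | rfl
    · exact glue_apply_of_lt _ h
    · have := glue_apply_add hq0 0
      rw [zero_add] at this
      rw [hzdef, this, hq0]
  · rw [show m + 1 + w.length = w.length + 1 + m by omega, Function.iterate_add_apply, hz,
      shift_iterate_glue]
  · rw [hs1]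
    have h1 : shift q ∈ cylinder A w := fun i hi => by
      change q.1 (i + 1) = w[i]
      rw [hq, glue_apply_of_lt _ (by omega), hpi i hi]
    have h2 : c w ≤ c0 := hc0 ⟨w, hwΛ, rfl⟩
    have h3 := hc w _ h1
    have h4 := le_max_left c0 0
    linarith

/-! ### The transfer operator on nonnegative extended functions -/

/-- The `n`-th iterate of the transfer operator of `u` on `[0, ∞]`-valued functions, written as
a sum over all `n`-th preimages, so that no summability or continuity is needed. -/
def transferIter {α : Type*} {A : α → α → Bool} (u : ShiftSpace A → ℝ) (n : ℕ)
    (φ : ShiftSpace A → ℝ≥0∞) (x : ShiftSpace A) : ℝ≥0∞ :=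
  ∑' y : {y : ShiftSpace A // shift^[n] y = x},
    ENNReal.ofReal (Real.exp (birkhoff n u y.1)) * φ y.1

theorem transferIter_zero {α : Type*} {A : α → α → Bool} (u : ShiftSpace A → ℝ)
    (φ : ShiftSpace A → ℝ≥0∞) (x : ShiftSpace A) : transferIter u 0 φ x = φ x := by
  unfold transferIter
  rw [tsum_eq_single (⟨x, rfl⟩ : {y : ShiftSpace A // shift^[0] y = x})
    fun y hy => absurd (Subtype.ext y.2) hy]
  simp [birkhoff]

theorem transferIter_one_eq {α : Type*} {A : α → α → Bool} (u : ShiftSpace A → ℝ)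
    (φ : ShiftSpace A → ℝ≥0∞) (x : ShiftSpace A) :
    transferIter u 1 φ x
      = ∑' y : {y : ShiftSpace A // shift y = x}, ENNReal.ofReal (Real.exp (u y.1)) * φ y.1 :=
  tsum_congr fun y : {y : ShiftSpace A // shift y = x} => by rw [birkhoff_one]

theorem transferIter_add {α : Type*} {A : α → α → Bool} (u : ShiftSpace A → ℝ) (m n : ℕ)
    (φ : ShiftSpace A → ℝ≥0∞) (x : ShiftSpace A) :
    transferIter u (m + n) φ x = transferIter u m (transferIter u n φ) x := by
  let e : {y : ShiftSpace A // shift^[m + n] y = x} ≃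
      (Σ z : {z : ShiftSpace A // shift^[m] z = x}, {y : ShiftSpace A // shift^[n] y = z.1}) :=
    { toFun := fun y =>
        ⟨⟨shift^[n] y.1, by rw [← Function.iterate_add_apply]; exact y.2⟩, ⟨y.1, rfl⟩⟩
      invFun := fun p =>
        ⟨p.2.1, by rw [Function.iterate_add_apply, p.2.2]; exact p.1.2⟩
      left_inv := fun _ => rfl
      right_inv := by
        rintro ⟨⟨z, hz⟩, ⟨y, hy⟩⟩
        dsimp only at hy
        subst hy
        rfl }
  unfold transferIter
  rw [← e.symm.tsum_eq, ENNReal.tsum_sigma']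
  refine tsum_congr fun z => ?_
  rw [← ENNReal.tsum_mul_left]
  refine tsum_congr fun y => ?_
  change ENNReal.ofReal (Real.exp (birkhoff (m + n) u y.1)) * φ y.1 = _
  rw [add_comm m n, birkhoff_add, y.2, Real.exp_add, ENNReal.ofReal_mul (Real.exp_pos _).le,
    mul_comm (ENNReal.ofReal (Real.exp (birkhoff n u y.1))), mul_assoc]

theorem transferIter_mono {α : Type*} {A : α → α → Bool} (u : ShiftSpace A → ℝ) (n : ℕ)
    {φ ψ : ShiftSpace A → ℝ≥0∞} (h : ∀ x, φ x ≤ ψ x) (x : ShiftSpace A) :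
    transferIter u n φ x ≤ transferIter u n ψ x :=
  ENNReal.tsum_le_tsum fun _ => mul_le_mul_right (h _) _

theorem transferIter_add_fun {α : Type*} {A : α → α → Bool} (u : ShiftSpace A → ℝ) (n : ℕ)
    (φ ψ : ShiftSpace A → ℝ≥0∞) (x : ShiftSpace A) :
    transferIter u n (fun y => φ y + ψ y) x = transferIter u n φ x + transferIter u n ψ x := by
  unfold transferIter
  rw [← ENNReal.tsum_add]
  exact tsum_congr fun _ => mul_add _ _ _

theorem transferIter_const_mul {α : Type*} {A : α → α → Bool} (u : ShiftSpace A → ℝ) (n : ℕ)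
    (c : ℝ≥0∞) (φ : ShiftSpace A → ℝ≥0∞) (x : ShiftSpace A) :
    transferIter u n (fun y => c * φ y) x = c * transferIter u n φ x := by
  unfold transferIter
  rw [← ENNReal.tsum_mul_left]
  exact tsum_congr fun _ => mul_left_comm _ _ _

theorem transferIter_const {α : Type*} {A : α → α → Bool} (u : ShiftSpace A → ℝ) (n : ℕ)
    (c : ℝ≥0∞) (x : ShiftSpace A) :
    transferIter u n (fun _ => c) x = c * transferIter u n (fun _ => 1) x := by
  rw [← transferIter_const_mul, mul_one]

theorem le_transferIter {α : Type*} {A : α → α → Bool} (u : ShiftSpace A → ℝ) (n : ℕ)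
    (φ : ShiftSpace A → ℝ≥0∞) (y : ShiftSpace A) :
    ENNReal.ofReal (Real.exp (birkhoff n u y)) * φ y ≤ transferIter u n φ (shift^[n] y) :=
  ENNReal.le_tsum (f := fun z : {z : ShiftSpace A // shift^[n] z = shift^[n] y} =>
    ENNReal.ofReal (Real.exp (birkhoff n u z.1)) * φ z.1) ⟨y, rfl⟩

/-- Subtracting a constant from the potential rescales the operator. -/
theorem transferIter_sub_const {α : Type*} {A : α → α → Bool} (u : ShiftSpace A → ℝ) (P : ℝ)
    (n : ℕ) (φ : ShiftSpace A → ℝ≥0∞) (x : ShiftSpace A) :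
    transferIter (fun y => u y - P) n φ x
      = ENNReal.ofReal (Real.exp (-(n * P))) * transferIter u n φ x := by
  unfold transferIter
  rw [← ENNReal.tsum_mul_left]
  refine tsum_congr fun y => ?_
  have : birkhoff n (fun y => u y - P) y.1 = -(n * P) + birkhoff n u y.1 := by
    simp [birkhoff, Finset.sum_sub_distrib]
    ring
  rw [this, Real.exp_add, ENNReal.ofReal_mul (Real.exp_pos _).le, mul_assoc]

/-- Two points with the same first `m + 1` letters have the same preimage branches, so the values
of the iterates of `1` differ at most by the distortion factor. -/
theorem transferIter_one_le_of_prefix {α : Type*} {A : α → α → Bool} {θ V : ℝ}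
    {u : ShiftSpace A → ℝ} (hu : HasVariationBound θ V u) (hθ0 : 0 < θ) (hθ1 : θ < 1) (hV : 0 ≤ V)
    (n m : ℕ) {x y : ShiftSpace A} (h : ∀ i < m + 1, x.1 i = y.1 i) :
    transferIter u n (fun _ => 1) x
      ≤ ENNReal.ofReal (Real.exp (V / (1 - θ) * θ ^ (m + 1)))
        * transferIter u n (fun _ => 1) y := by
  have h0 : ∀ z : {z : ShiftSpace A // shift^[n] z = x}, z.1.1 n = y.1 0 := by
    intro z
    have := shift_iterate_apply n z.1 0
    rwa [z.2, zero_add, h 0 (Nat.succ_pos m), eq_comm] at this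
  let g : {z : ShiftSpace A // shift^[n] z = x} → {z : ShiftSpace A // shift^[n] z = y} :=
    fun z => ⟨glue n z.1 y (h0 z), shift_iterate_glue _⟩
  have hg : Function.Injective g := by
    intro z z' hzz
    refine Subtype.ext (eq_of_prefix_of_shift_iterate (n := n) (fun i hi => ?_)
      (z.2.trans z'.2.symm))
    have := congrArg (fun t : {z : ShiftSpace A // shift^[n] z = y} => t.1.1 i) hzz
    simpa only [g, glue_apply_of_lt _ hi] using this
  unfold transferIter
  refine le_trans ?_ (mul_le_mul_right (ENNReal.tsum_comp_le_tsum_of_injective hg _) _)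
  rw [← ENNReal.tsum_mul_left]
  refine ENNReal.tsum_le_tsum fun z => ?_
  rw [mul_one, mul_one, ← ENNReal.ofReal_mul (Real.exp_pos _).le, ← Real.exp_add]
  refine ENNReal.ofReal_le_ofReal (Real.exp_le_exp.2 ?_)
  rw [add_comm]
  refine hu.birkhoff_le hθ0 hθ1 hV n (m + 1) fun i hi => ?_
  rcases lt_or_ge i n with hin | hin
  · exact (glue_apply_of_lt (h0 z) hin).symm
  · obtain ⟨j, rfl⟩ := Nat.exists_eq_add_of_le' hin
    change _ = (glue n z.1 y (h0 z)).1 (j + n)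
    rw [glue_apply_add, ← h j (by omega), ← shift_iterate_apply, z.2]

/-! ### The pressure and uniform bounds for the iterates of `1` -/

/-- Fekete's lemma for a positive sequence that is multiplicative up to a constant factor, with the
resulting two-sided exponential bounds. -/
theorem exists_tendsto_log_div_of_almost_multiplicative {z : ℕ → ℝ} {C : ℝ} (hC : 1 ≤ C)
    (hz : ∀ n, 0 < z n) (h1 : ∀ m n, z (m + n) ≤ C * (z m * z n))
    (h2 : ∀ m n, z m * z n ≤ C * z (m + n)) :
    ∃ P : ℝ, Tendsto (fun n : ℕ => Real.log (z n) / n) atTop (𝓝 P) ∧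
      ∀ n : ℕ, Real.exp (n * P) ≤ C * z n ∧ z n ≤ C * Real.exp (n * P) := by
  have hC0 : 0 < C := one_pos.trans_le hC
  have hl : 0 ≤ Real.log C := Real.log_nonneg hC
  have ha : Subadditive fun n => Real.log C + Real.log (z n) := fun m n => by
    have := Real.log_le_log (hz _) (h1 m n)
    rw [Real.log_mul hC0.ne' (mul_pos (hz m) (hz n)).ne',
      Real.log_mul (hz m).ne' (hz n).ne'] at this
    beta_reduce
    linarith
  have hb : Subadditive fun n => Real.log C - Real.log (z n) := fun m n => by
    have := Real.log_le_log (mul_pos (hz m) (hz n)) (h2 m n)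
    rw [Real.log_mul hC0.ne' (hz _).ne', Real.log_mul (hz m).ne' (hz n).ne'] at this
    beta_reduce
    linarith
  -- Each of the two subadditive sequences bounds the other from below, linearly in `n`.
  have hlin : ∀ a : ℕ → ℝ, Subadditive a → ∀ n : ℕ, 1 ≤ n → a n ≤ n * a 1 := by
    intro a h n hn
    induction n, hn using Nat.le_induction with
    | base => simp
    | succ n _ ih =>
      have := h n 1
      push_cast
      linarith
  have hbdd : ∀ a b : ℕ → ℝ, Subadditive b → (∀ n, 0 ≤ a n + b n) →
      BddBelow (Set.range fun n : ℕ => a n / n) := by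
    intro a b h hab
    refine ⟨min (-b 1) 0, ?_⟩
    rintro _ ⟨n, rfl⟩
    rcases Nat.eq_zero_or_pos n with rfl | hn
    · simp
    · refine (min_le_left _ _).trans ?_
      have hn' : (0 : ℝ) < n := Nat.cast_pos.2 hn
      rw [le_div_iff₀ hn']
      have := hlin b h n hn
      have := hab n
      linarith
  have hba := hbdd (fun n => Real.log C + Real.log (z n)) _ hb fun n => by linarith
  have hbb := hbdd (fun n => Real.log C - Real.log (z n)) _ ha fun n => by linarith
  have hta := ha.tendsto_lim hba
  have htb := hb.tendsto_lim hbb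
  have h0 : Tendsto (fun n : ℕ => Real.log C / (n : ℝ)) atTop (𝓝 0) :=
    tendsto_const_div_atTop_nhds_zero_nat _
  have hP : Tendsto (fun n : ℕ => Real.log (z n) / (n : ℝ)) atTop (𝓝 ha.lim) := by
    have := hta.sub h0
    rw [sub_zero] at this
    refine this.congr fun n => ?_
    ring
  have hlim : hb.lim = -ha.lim := by
    refine tendsto_nhds_unique htb ?_
    have := h0.sub hP
    rw [zero_sub] at this
    refine this.congr fun n => ?_
    ring
  refine ⟨ha.lim, hP, fun n => ?_⟩
  rcases Nat.eq_zero_or_pos n with rfl | hn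
  · have e1 := h1 0 0
    have e2 := h2 0 0
    have hz0 := hz 0
    simp only [Nat.cast_zero, zero_mul, Real.exp_zero, mul_one, add_zero] at e1 e2 ⊢
    constructor
    · by_contra! h
      nlinarith
    · exact le_of_mul_le_mul_right e2 hz0
  · have hn' : (0 : ℝ) < n := Nat.cast_pos.2 hn
    have e1 := ha.lim_le_div hba hn.ne'
    have e2 := hb.lim_le_div hbb hn.ne'
    rw [hlim] at e2
    rw [le_div_iff₀ hn'] at e1 e2
    constructor
    · rw [← Real.log_le_log_iff (Real.exp_pos _) (mul_pos hC0 (hz n)), Real.log_exp,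
        Real.log_mul hC0.ne' (hz n).ne']
      linarith
    · rw [← Real.log_le_log_iff (hz n) (mul_pos hC0 (Real.exp_pos _)),
        Real.log_mul hC0.ne' (Real.exp_pos _).ne', Real.log_exp]
      linarith

theorem ofReal_exp_le_exp_iSup {α : Type*} {A : α → α → Bool} (v : ShiftSpace A → ℝ)
    {s : Set (ShiftSpace A)} {y : ShiftSpace A} (hy : y ∈ s) :
    ENNReal.ofReal (Real.exp (v y)) ≤ EReal.exp (⨆ x ∈ s, (v x : EReal)) := by
  rw [← EReal.exp_coe]
  exact EReal.exp_monotone (le_iSup₂ (f := fun x (_ : x ∈ s) => (v x : EReal)) y hy)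

theorem ofFn_mem_words {α : Type*} {A : α → α → Bool} (n : ℕ) (x : ShiftSpace A) :
    (List.ofFn fun i : Fin n => x.1 i) ∈ words A n :=
  ⟨List.length_ofFn, Or.inr ⟨x, 0, fun i hi => by simp⟩⟩

theorem exists_mem_cylinder {α : Type*} {A : α → α → Bool} [Nonempty (ShiftSpace A)] {n : ℕ}
    (w : words A n) : ∃ x, x ∈ cylinder A w.1 := by
  obtain ⟨w, hn, rfl | ⟨x, k, hk⟩⟩ := w
  · exact ⟨Classical.arbitrary _, fun i hi => absurd hi (Nat.not_lt_zero i)⟩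
  · refine ⟨shift^[k] x, fun i hi => ?_⟩
    rw [shift_iterate_apply, add_comm]
    exact (hk i hi).symm

theorem transferIter_one_le_partitionSum {α : Type*} {A : α → α → Bool} (u : ShiftSpace A → ℝ)
    (n : ℕ) (x : ShiftSpace A) : transferIter u n (fun _ => 1) x ≤ partitionSum u n := by
  let g : {y : ShiftSpace A // shift^[n] y = x} → words A n :=
    fun y => ⟨List.ofFn fun i : Fin n => y.1.1 i, ofFn_mem_words n y.1⟩
  have hg : Function.Injective g := by
    intro y z h
    refine Subtype.ext (eq_of_prefix_of_shift_iterate (n := n) (fun i hi => ?_)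
      (y.2.trans z.2.symm))
    exact congrFun (List.ofFn_injective (congrArg Subtype.val h)) ⟨i, hi⟩
  refine le_trans ?_ (ENNReal.tsum_comp_le_tsum_of_injective hg _)
  refine ENNReal.tsum_le_tsum fun y => ?_
  rw [mul_one]
  exact ofReal_exp_le_exp_iSup (birkhoff n u) fun i hi => by simp [g]

theorem transferIter_one_one_le {α : Type*} {A : α → α → Bool} (u : ShiftSpace A → ℝ)
    (x : ShiftSpace A) :
    transferIter u 1 (fun _ => 1) x
      ≤ ∑' e : α, EReal.exp (⨆ x ∈ cylinder A [e], (u x : EReal)) := by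
  rw [transferIter_one_eq]
  refine le_trans ?_ (ENNReal.tsum_comp_le_tsum_of_injective (injective_first_letter x) _)
  refine ENNReal.tsum_le_tsum fun y => ?_
  rw [mul_one]
  refine ofReal_exp_le_exp_iSup u fun i hi => ?_
  have hi0 : i = 0 := by simpa using hi
  subst hi0
  rfl

theorem transferIter_one_le_pow {α : Type*} {A : α → α → Bool} {u : ShiftSpace A → ℝ} {M : ℝ≥0∞}
    (hM : ∀ x, transferIter u 1 (fun _ => 1) x ≤ M) (n : ℕ) (x : ShiftSpace A) :
    transferIter u n (fun _ => 1) x ≤ M ^ n := by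
  induction n generalizing x with
  | zero => rw [transferIter_zero, pow_zero]
  | succ n ih =>
    rw [add_comm, transferIter_add]
    calc _ ≤ transferIter u 1 (fun _ => M ^ n) x := transferIter_mono u 1 ih x
      _ = M ^ n * transferIter u 1 (fun _ => 1) x := transferIter_const _ _ _ _
      _ ≤ M ^ n * M := mul_le_mul_right (hM x) _
      _ = M ^ (1 + n) := by rw [add_comm, pow_succ]

/-- The partition sum is dominated by the iterates of `1` at any single point: every admissible
word is continued to that point by a connecting word of bounded length. -/
theorem exists_partitionSum_le {α : Type*} {A : α → α → Bool} [Nonempty (ShiftSpace A)] {θ V : ℝ}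
    {u : ShiftSpace A → ℝ} (hA : FinitelyIrreducible A) (hu : HasVariationBound θ V u)
    (hθ0 : 0 < θ) (hθ1 : θ < 1) (hV : 0 ≤ V) {M : ℝ≥0∞} (hMtop : M ≠ ∞)
    (hM : ∀ x, transferIter u 1 (fun _ => 1) x ≤ M) :
    ∃ C : ℝ≥0∞, C ≠ ∞ ∧ ∀ n x, partitionSum u n ≤ C * transferIter u n (fun _ => 1) x := by
  obtain ⟨N, c, hconn⟩ := exists_connection hA hu hθ0 hθ1 hV
  refine ⟨ENNReal.ofReal (Real.exp (V / (1 - θ) + c)) * ∑ k : Fin (N + 1), M ^ (k : ℕ),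
    ENNReal.mul_ne_top ENNReal.ofReal_ne_top
      (ENNReal.sum_ne_top.2 fun k _ => ENNReal.pow_ne_top hMtop), fun n x => ?_⟩
  choose y hy using fun w : words A n => exists_mem_cylinder w
  choose k hk z hz hzx hzb using fun w : words A n => hconn (y w) x n
  have hlen : ∀ w : words A n, w.1.length = n := fun w => w.2.1
  have hzw : ∀ w : words A n, z w ∈ cylinder A w.1 := fun w i hi =>
    (hz w i (hi.trans_eq (hlen w))).trans (hy w i hi)
  let g : words A n → Σ k : Fin (N + 1), {y : ShiftSpace A // shift^[n + k] y = x} :=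
    fun w => ⟨⟨k w, Nat.lt_succ_of_le (hk w)⟩, ⟨z w, hzx w⟩⟩
  have hg : Function.Injective g := by
    intro w w' h
    have hzz : z w = z w' := congrArg
      (fun p : Σ k : Fin (N + 1), {y : ShiftSpace A // shift^[n + k] y = x} => p.2.1) h
    refine Subtype.ext (List.ext_getElem ((hlen w).trans (hlen w').symm) fun i h1 h2 => ?_)
    rw [← hzw w i h1, hzz, hzw w' i h2]
  let F : (Σ k : Fin (N + 1), {y : ShiftSpace A // shift^[n + k] y = x}) → ℝ≥0∞ :=
    fun p => ENNReal.ofReal (Real.exp (birkhoff (n + p.1) u p.2.1)) * 1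
  have hterm : ∀ w : words A n,
      EReal.exp (⨆ x ∈ cylinder A w.1, (birkhoff n u x : EReal))
        ≤ ENNReal.ofReal (Real.exp (V / (1 - θ) + c)) * F (g w) := by
    intro w
    have h1 : (⨆ x ∈ cylinder A w.1, (birkhoff n u x : EReal))
        ≤ ((V / (1 - θ) + c + birkhoff (n + k w) u (z w) : ℝ) : EReal) := by
      refine iSup₂_le fun t ht => EReal.coe_le_coe_iff.2 ?_
      have h2 := hu.birkhoff_le hθ0 hθ1 hV n 0 (x := t) (y := z w) fun i hi =>
        (ht i (hi.trans_eq (hlen w).symm)).trans (hzw w i (hi.trans_eq (hlen w).symm)).symm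
      rw [pow_zero, mul_one] at h2
      have h3 := hzb w
      rw [birkhoff_add]
      linarith
    refine (EReal.exp_monotone h1).trans_eq ?_
    rw [EReal.exp_coe, Real.exp_add, ENNReal.ofReal_mul (Real.exp_pos _).le]
    simp only [F, g, mul_one]
  calc partitionSum u n
      ≤ ∑' w : words A n, ENNReal.ofReal (Real.exp (V / (1 - θ) + c)) * F (g w) :=
        ENNReal.tsum_le_tsum hterm
    _ = ENNReal.ofReal (Real.exp (V / (1 - θ) + c)) * ∑' w : words A n, F (g w) :=
        ENNReal.tsum_mul_left
    _ ≤ ENNReal.ofReal (Real.exp (V / (1 - θ) + c)) * ∑' p, F p :=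
        mul_le_mul_right (ENNReal.tsum_comp_le_tsum_of_injective hg F) _
    _ = ENNReal.ofReal (Real.exp (V / (1 - θ) + c))
          * ∑ k : Fin (N + 1), transferIter u (n + k) (fun _ => 1) x := by
        rw [ENNReal.tsum_sigma', tsum_fintype]
        rfl
    _ ≤ ENNReal.ofReal (Real.exp (V / (1 - θ) + c))
          * ∑ k : Fin (N + 1), M ^ (k : ℕ) * transferIter u n (fun _ => 1) x := by
        refine mul_le_mul_right (Finset.sum_le_sum fun k _ => ?_) _
        rw [transferIter_add, ← transferIter_const]
        exact transferIter_mono u n (transferIter_one_le_pow hM k) x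
    _ = _ := by rw [← Finset.sum_mul, mul_assoc]

/-- The pressure exists and is finite, and the iterates of `1` under the operator of the normalised
potential `u - P` are bounded above and bounded away from `0`. -/
theorem exists_hasPressure {α : Type*} {A : α → α → Bool} [Nonempty (ShiftSpace A)] {θ V : ℝ}
    {u : ShiftSpace A → ℝ} (hA : FinitelyIrreducible A) (hu : HasVariationBound θ V u)
    (hθ0 : 0 < θ) (hθ1 : θ < 1) (hV : 0 ≤ V) (hs : IsSummable u) :
    ∃ P : ℝ, HasPressure u P ∧ ∃ C : ℝ, 0 < C ∧ ∀ n x,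
      ENNReal.ofReal C⁻¹ ≤ transferIter (fun y => u y - P) n (fun _ => 1) x ∧
      transferIter (fun y => u y - P) n (fun _ => 1) x ≤ ENNReal.ofReal C := by
  obtain ⟨B₀, hB₀top, hB₀⟩ := exists_partitionSum_le hA hu hθ0 hθ1 hV hs.ne
    (transferIter_one_one_le u)
  obtain ⟨B, hB1, hB⟩ : ∃ B : ℝ, 1 ≤ B ∧
      ∀ n x, partitionSum u n ≤ ENNReal.ofReal B * transferIter u n (fun _ => 1) x := by
    refine ⟨max B₀.toReal 1, le_max_right _ _, fun n x => (hB₀ n x).trans ?_⟩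
    exact mul_le_mul_left ((ENNReal.ofReal_toReal hB₀top).symm.trans_le
      (ENNReal.ofReal_le_ofReal (le_max_left _ _))) _
  have hB0 : 0 < B := one_pos.trans_le hB1
  let x₀ : ShiftSpace A := Classical.arbitrary _
  have hle := transferIter_one_le_partitionSum u
  have htop : ∀ n, partitionSum u n ≠ ∞ := fun n =>
    ((hB n x₀).trans_lt (ENNReal.mul_lt_top ENNReal.ofReal_lt_top
      ((transferIter_one_le_pow (transferIter_one_one_le u) n x₀).trans_lt
        (ENNReal.pow_lt_top hs)))).ne
  have hpos : ∀ n, partitionSum u n ≠ 0 := fun n => by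
    have h1 := (le_transferIter u n (fun _ => 1) x₀).trans (hle n _)
    rw [mul_one] at h1
    exact ((ENNReal.ofReal_pos.2 (Real.exp_pos _)).trans_le h1).ne'
  -- Both multiplicativity estimates come from the semigroup property of the operator, because the
  -- partition sums and the iterates of `1` agree up to the factor `B`.
  have hsub : ∀ m n, partitionSum u (m + n)
      ≤ ENNReal.ofReal B * (partitionSum u m * partitionSum u n) := fun m n => by
    refine (hB (m + n) x₀).trans (mul_le_mul_right ?_ _)
    rw [transferIter_add]
    calc _ ≤ transferIter u m (fun _ => partitionSum u n) x₀ := transferIter_mono u m (hle n) x₀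
      _ = partitionSum u n * transferIter u m (fun _ => 1) x₀ := transferIter_const _ _ _ _
      _ ≤ partitionSum u n * partitionSum u m := mul_le_mul_right (hle m x₀) _
      _ = _ := mul_comm _ _
  have hsup : ∀ m n, partitionSum u m * partitionSum u n
      ≤ ENNReal.ofReal B * (ENNReal.ofReal B * partitionSum u (m + n)) := fun m n => by
    calc partitionSum u m * partitionSum u n
        ≤ ENNReal.ofReal B * transferIter u m (fun _ => 1) x₀ * partitionSum u n :=
          mul_le_mul_left (hB m x₀) _
      _ = ENNReal.ofReal B * transferIter u m (fun _ => partitionSum u n) x₀ := by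
          rw [transferIter_const u m (partitionSum u n), mul_assoc, mul_comm (partitionSum u n)]
      _ ≤ ENNReal.ofReal B * transferIter u m
            (fun y => ENNReal.ofReal B * transferIter u n (fun _ => 1) y) x₀ :=
          mul_le_mul_right (transferIter_mono u m (hB n) x₀) _
      _ = ENNReal.ofReal B * (ENNReal.ofReal B * transferIter u (m + n) (fun _ => 1) x₀) := by
          rw [transferIter_const_mul, transferIter_add]
      _ ≤ _ := by gcongr; exact hle _ _
  have hZ : ∀ n, partitionSum u n = ENNReal.ofReal (partitionSum u n).toReal := fun n =>
    (ENNReal.ofReal_toReal (htop n)).symm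
  set z : ℕ → ℝ := fun n => (partitionSum u n).toReal with hzdef
  have hz : ∀ n, 0 < z n := fun n => ENNReal.toReal_pos (hpos n) (htop n)
  have hz' : ∀ n, 0 ≤ z n := fun n => (hz n).le
  have hBB : B ≤ B * B := le_mul_of_one_le_left hB0.le hB1
  obtain ⟨P, hP, hexp⟩ := exists_tendsto_log_div_of_almost_multiplicative (z := z) (C := B * B)
    (hB1.trans hBB) hz (fun m n => by
      have h := hsub m n
      rw [hZ, hZ m, hZ n, ← ENNReal.ofReal_mul (hz' m), ← ENNReal.ofReal_mul hB0.le,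
        ENNReal.ofReal_le_ofReal_iff (mul_nonneg hB0.le (mul_nonneg (hz' m) (hz' n)))] at h
      exact h.trans (mul_le_mul_of_nonneg_right hBB (mul_nonneg (hz' m) (hz' n))))
    (fun m n => by
      have h := hsup m n
      rw [hZ (m + n), hZ m, hZ n, ← ENNReal.ofReal_mul (hz' m), ← ENNReal.ofReal_mul hB0.le,
        ← ENNReal.ofReal_mul hB0.le, ← mul_assoc, ENNReal.ofReal_le_ofReal_iff
          (mul_nonneg (mul_nonneg hB0.le hB0.le) (hz' _))] at h
      exact h)
  refine ⟨P, ?_, B * B * B, by positivity, fun n x => ?_⟩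
  · have hcoe : Tendsto (fun n : ℕ => ((Real.log (z n) / n : ℝ) : EReal)) atTop
        (𝓝 (P : EReal)) := (continuous_coe_real_ereal.tendsto P).comp hP
    refine hcoe.congr fun n => ?_
    rw [hZ n, ENNReal.log_ofReal_of_pos (hz n), EReal.coe_div]
    rfl
  · obtain ⟨e1, e2⟩ := hexp n
    rw [transferIter_sub_const]
    have hneg : Real.exp (-(n * P)) * Real.exp (n * P) = 1 := by
      rw [← Real.exp_add, neg_add_cancel, Real.exp_zero]
    constructor
    · have h1 : ENNReal.ofReal (Real.exp (-(n * P)) * z n)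
          ≤ ENNReal.ofReal B
            * (ENNReal.ofReal (Real.exp (-(n * P))) * transferIter u n (fun _ => 1) x) := by
        rw [ENNReal.ofReal_mul (Real.exp_pos _).le, mul_left_comm, ← hZ n]
        exact mul_le_mul_right (hB n x) _
      have h2 : 1 ≤ B * B * (Real.exp (-(n * P)) * z n) := by
        rw [← hneg, mul_left_comm]
        exact mul_le_mul_of_nonneg_left e1 (Real.exp_pos _).le
      have h3 : ENNReal.ofReal (B * (B * B * B)⁻¹)
          ≤ ENNReal.ofReal (Real.exp (-(n * P)) * z n) := by
        refine ENNReal.ofReal_le_ofReal ?_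
        have : B * (B * B * B)⁻¹ = (B * B)⁻¹ := by field_simp
        rw [this, inv_le_iff_one_le_mul₀ (mul_pos hB0 hB0), mul_comm]
        exact h2
      have h4 := h3.trans h1
      rw [ENNReal.ofReal_mul hB0.le] at h4
      exact (ENNReal.mul_le_mul_iff_right (ENNReal.ofReal_pos.2 hB0).ne'
        ENNReal.ofReal_ne_top).1 h4
    · calc _ ≤ ENNReal.ofReal (Real.exp (-(n * P))) * partitionSum u n :=
            mul_le_mul_right (hle n x) _
        _ = ENNReal.ofReal (Real.exp (-(n * P)) * z n) := by
            rw [ENNReal.ofReal_mul (Real.exp_pos _).le, ← hZ n]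
        _ ≤ ENNReal.ofReal (B * B * B) := by
            refine ENNReal.ofReal_le_ofReal ?_
            have h1 : Real.exp (-(n * P)) * z n ≤ B * B := by
              calc _ ≤ Real.exp (-(n * P)) * (B * B * Real.exp (n * P)) :=
                    mul_le_mul_of_nonneg_left e2 (Real.exp_pos _).le
                _ = B * B * (Real.exp (-(n * P)) * Real.exp (n * P)) := by ring
                _ = B * B := by rw [hneg, mul_one]
            exact h1.trans (le_mul_of_one_le_right (by positivity) hB1)

/-! ### Strictly subinvariant functions -/

/-- If `φ ≥ δ` on a cylinder, then at every point one of boundedly many iterates of `φ` is at least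
a fixed multiple of `δ`. -/
theorem exists_le_transferIter {α : Type*} {A : α → α → Bool} {θ V : ℝ} {u : ShiftSpace A → ℝ}
    (hA : FinitelyIrreducible A) (hu : HasVariationBound θ V u) (hθ0 : 0 < θ) (hθ1 : θ < 1)
    (hV : 0 ≤ V) (x₀ : ShiftSpace A) (n : ℕ) :
    ∃ (M : ℕ) (c : ℝ≥0∞), c ≠ 0 ∧ ∀ (φ : ShiftSpace A → ℝ≥0∞) (δ : ℝ≥0∞),
      (∀ z : ShiftSpace A, (∀ i < n, z.1 i = x₀.1 i) → δ ≤ φ z) →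
        ∀ x, ∃ k ≤ M, c * δ ≤ transferIter u k φ x := by
  obtain ⟨N, c, hconn⟩ := exists_connection hA hu hθ0 hθ1 hV
  refine ⟨n + N, ENNReal.ofReal (Real.exp (birkhoff n u x₀ - V / (1 - θ) - c)),
    (ENNReal.ofReal_pos.2 (Real.exp_pos _)).ne', fun φ δ hφ x => ?_⟩
  obtain ⟨k, hk, z, hz, hzx, hb⟩ := hconn x₀ x n
  refine ⟨n + k, by omega, ?_⟩
  have h1 := le_transferIter u (n + k) φ z
  rw [hzx] at h1
  refine le_trans (mul_le_mul' (ENNReal.ofReal_le_ofReal (Real.exp_le_exp.2 ?_)) (hφ z hz)) h1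
  have h2 := hu.birkhoff_le hθ0 hθ1 hV n 0 (x := x₀) (y := z) fun i hi => (hz i hi).symm
  rw [pow_zero, mul_one] at h2
  rw [birkhoff_add]
  linarith

/-- A bounded function cannot be strictly subinvariant on a cylinder: the gain `D` would spread to
all points within boundedly many steps and would accumulate beyond the bound. -/
theorem eq_zero_of_add_le_transferIter {α : Type*} {A : α → α → Bool} [Nonempty (ShiftSpace A)]
    {θ V : ℝ} {u : ShiftSpace A → ℝ}
    (hA : FinitelyIrreducible A) (hu : HasVariationBound θ V u) (hθ0 : 0 < θ) (hθ1 : θ < 1)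
    (hV : 0 ≤ V) {c₀ C W : ℝ≥0∞} (hc₀ : c₀ ≠ 0) (hC : C ≠ ∞) (hW : W ≠ ∞)
    (hlow : ∀ n x, c₀ ≤ transferIter u n (fun _ => 1) x)
    (hupp : ∀ n x, transferIter u n (fun _ => 1) x ≤ C)
    {w D : ShiftSpace A → ℝ≥0∞} (hwW : ∀ x, w x ≤ W)
    (hD : ∀ x, w x + D x ≤ transferIter u 1 w x) (x₀ : ShiftSpace A) (n : ℕ) {δ : ℝ≥0∞}
    (hδ : ∀ z : ShiftSpace A, (∀ i < n, z.1 i = x₀.1 i) → δ ≤ D z) : δ = 0 := by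
  obtain ⟨M, c, hc, hspread⟩ := exists_le_transferIter hA hu hθ0 hθ1 hV x₀ n
  by_contra hδ0
  have hstep : ∀ k x, transferIter u k w x + transferIter u k D x
      ≤ transferIter u (k + 1) w x := fun k x => by
    rw [transferIter_add, ← transferIter_add_fun]
    exact transferIter_mono u k hD x
  have hmono : ∀ x, Monotone fun k => transferIter u k w x := fun x =>
    monotone_nat_of_le_succ fun k => le_self_add.trans (hstep k x)
  have hgain : ∀ x, w x + c * δ ≤ transferIter u (M + 1) w x := fun x => by
    obtain ⟨k, hk, hkx⟩ := hspread D δ hδ x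
    calc w x + c * δ ≤ transferIter u k w x + transferIter u k D x := by
          refine add_le_add ?_ hkx
          have := hmono x (Nat.zero_le k)
          simpa only [transferIter_zero] using this
      _ ≤ transferIter u (k + 1) w x := hstep k x
      _ ≤ transferIter u (M + 1) w x := hmono x (Nat.succ_le_succ hk)
  -- Each further `M + 1` steps add the gain `c * δ`, transported by the iterates of `1 ≥ c₀`.
  have hgrow : ∀ (j : ℕ) (x), (j : ℝ≥0∞) * (c * δ * c₀) ≤ transferIter u (j * (M + 1)) w x := by
    intro j
    induction j with
    | zero => intro x; simp
    | succ j ih =>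
      intro x
      rw [Nat.succ_mul, transferIter_add]
      calc ((j + 1 : ℕ) : ℝ≥0∞) * (c * δ * c₀)
          = (j : ℝ≥0∞) * (c * δ * c₀) + c * δ * c₀ := by push_cast; ring
        _ ≤ transferIter u (j * (M + 1)) w x
            + c * δ * transferIter u (j * (M + 1)) (fun _ => 1) x :=
          add_le_add (ih x) (mul_le_mul_right (hlow _ x) _)
        _ = transferIter u (j * (M + 1)) (fun y => w y + c * δ) x := by
          rw [← transferIter_const, ← transferIter_add_fun]
        _ ≤ _ := transferIter_mono u _ hgain x
  obtain ⟨j, hj⟩ := ENNReal.exists_nat_mul_gt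
    (mul_ne_zero (mul_ne_zero hc hδ0) hc₀) (ENNReal.mul_ne_top hW hC)
  have h1 : transferIter u (j * (M + 1)) w x₀ ≤ W * C := by
    calc _ ≤ transferIter u (j * (M + 1)) (fun _ => W) x₀ := transferIter_mono u _ hwW x₀
      _ = W * transferIter u (j * (M + 1)) (fun _ => 1) x₀ := transferIter_const _ _ _ _
      _ ≤ W * C := mul_le_mul_right (hupp _ _) _
  exact absurd (hj.trans_le ((hgrow j x₀).trans h1)) (lt_irrefl _)

/-! ### Cylinders as neighbourhoods -/

theorem prefix_mem_nhds {α : Type*} [TopologicalSpace α] [DiscreteTopology α] {A : α → α → Bool}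
    (x : ShiftSpace A) (n : ℕ) : {y : ShiftSpace A | ∀ i < n, y.1 i = x.1 i} ∈ 𝓝 x := by
  have h : IsOpen (PiNat.cylinder (E := fun _ => α) x.1 n) := PiNat.isOpen_cylinder _ _ _
  exact (h.preimage continuous_subtype_val).mem_nhds fun i _ => rfl

theorem exists_prefix_subset_of_mem_nhds {α : Type*} [TopologicalSpace α] [DiscreteTopology α]
    {A : α → α → Bool} {x : ShiftSpace A} {s : Set (ShiftSpace A)} (hs : s ∈ 𝓝 x) :
    ∃ n, ∀ y : ShiftSpace A, (∀ i < n, y.1 i = x.1 i) → y ∈ s := by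
  rw [nhds_subtype_eq_comap, mem_comap] at hs
  obtain ⟨t, ht, hts⟩ := hs
  obtain ⟨o, ho, hxo, hot⟩ :=
    (PiNat.isTopologicalBasis_cylinders fun _ : ℕ => α).mem_nhds_iff.1 ht
  obtain ⟨z, n, rfl⟩ := ho
  refine ⟨n, fun y hy => hts (hot fun i hi => ?_)⟩
  exact (hy i hi).trans (hxo i hi)

/-! ### A positive eigenfunction -/

/-- A positive continuous eigenfunction of the normalised operator: a limit, along an ultrafilter,
of the Cesàro means of the iterates of `1`. Continuity comes from the uniform distortion bound, the
eigenvalue equation from dominated convergence. -/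
theorem exists_eigenfunction {α : Type*} [TopologicalSpace α] [DiscreteTopology α]
    {A : α → α → Bool} {θ V : ℝ} {u : ShiftSpace A → ℝ} (hu : HasVariationBound θ V u)
    (hθ0 : 0 < θ) (hθ1 : θ < 1) (hV : 0 ≤ V) {C : ℝ} (hC : 0 < C)
    (hlow : ∀ n x, ENNReal.ofReal C⁻¹ ≤ transferIter u n (fun _ => 1) x)
    (hupp : ∀ n x, transferIter u n (fun _ => 1) x ≤ ENNReal.ofReal C) :
    ∃ h : ShiftSpace A → ℝ, Continuous h ∧ (∀ x, C⁻¹ ≤ h x ∧ h x ≤ C) ∧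
      ∀ x, ∑' y : {y : ShiftSpace A // shift y = x}, Real.exp (u y.1) * h y.1 = h x := by
  have htop : ∀ n x, transferIter u n (fun _ => 1) x ≠ ∞ := fun n x =>
    ((hupp n x).trans_lt ENNReal.ofReal_lt_top).ne
  let a : ℕ → ShiftSpace A → ℝ := fun k x => (transferIter u k (fun _ => 1) x).toReal
  have ha : ∀ k x, C⁻¹ ≤ a k x ∧ a k x ≤ C := fun k x =>
    ⟨(ENNReal.ofReal_le_iff_le_toReal (htop k x)).1 (hlow k x),
      ENNReal.toReal_le_of_le_ofReal hC.le (hupp k x)⟩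
  have hexp : ∀ x, Summable fun y : {y : ShiftSpace A // shift y = x} => Real.exp (u y.1) := by
    intro x
    refine (ENNReal.summable_toReal (htop 1 x)).congr fun y => ?_
    rw [mul_one, birkhoff_one, ENNReal.toReal_ofReal (Real.exp_pos _).le]
  have hsum : ∀ {b : ShiftSpace A → ℝ}, (∀ y, C⁻¹ ≤ b y ∧ b y ≤ C) → ∀ x,
      ∀ y : {y : ShiftSpace A // shift y = x}, ‖Real.exp (u y.1) * b y.1‖
        ≤ Real.exp (u y.1) * C := by
    intro b hb x y
    have h0 : 0 ≤ b y.1 := (inv_pos.2 hC).le.trans (hb y.1).1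
    rw [Real.norm_of_nonneg (mul_nonneg (Real.exp_pos _).le h0)]
    exact mul_le_mul_of_nonneg_left (hb y.1).2 (Real.exp_pos _).le
  have hstep : ∀ k x, ∑' y : {y : ShiftSpace A // shift y = x}, Real.exp (u y.1) * a k y.1
      = a (k + 1) x := by
    intro k x
    change _ = (transferIter u (k + 1) (fun _ => 1) x).toReal
    rw [add_comm, transferIter_add, transferIter_one_eq,
      ENNReal.tsum_toReal_eq fun y : {y : ShiftSpace A // shift y = x} =>
        ENNReal.mul_ne_top ENNReal.ofReal_ne_top (htop k y.1)]
    refine tsum_congr fun y => ?_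
    rw [ENNReal.toReal_mul, ENNReal.toReal_ofReal (Real.exp_pos _).le]
  let H : ℕ → ShiftSpace A → ℝ := fun N x => (∑ k ∈ Finset.range (N + 1), a k x) / (N + 1 : ℝ)
  have hN : ∀ N : ℕ, (0 : ℝ) < N + 1 := fun N => by positivity
  have hH : ∀ N x, C⁻¹ ≤ H N x ∧ H N x ≤ C := by
    intro N x
    constructor
    · rw [le_div_iff₀ (hN N)]
      have := Finset.card_nsmul_le_sum (Finset.range (N + 1)) (fun k => a k x) C⁻¹
        fun k _ => (ha k x).1
      rw [Finset.card_range, nsmul_eq_mul] at this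
      push_cast at this
      linarith
    · rw [div_le_iff₀ (hN N)]
      have := Finset.sum_le_card_nsmul (Finset.range (N + 1)) (fun k => a k x) C
        fun k _ => (ha k x).2
      rw [Finset.card_range, nsmul_eq_mul] at this
      push_cast at this
      linarith
  -- The eigenvalue equation for the Cesàro means holds up to a telescoping boundary term.
  have hHstep : ∀ N x, ∑' y : {y : ShiftSpace A // shift y = x}, Real.exp (u y.1) * H N y.1
      = H N x + (a (N + 1) x - a 0 x) / (N + 1 : ℝ) := by
    intro N x
    have h1 : ∀ y : {y : ShiftSpace A // shift y = x}, Real.exp (u y.1) * H N y.1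
        = (∑ k ∈ Finset.range (N + 1), Real.exp (u y.1) * a k y.1) / (N + 1 : ℝ) := by
      intro y
      rw [← Finset.mul_sum, mul_div_assoc]
    rw [tsum_congr h1, tsum_div_const, Summable.tsum_finsetSum fun k _ =>
      Summable.of_norm_bounded ((hexp x).mul_right C) (hsum (ha k) x),
      Finset.sum_congr rfl fun k _ => hstep k x, ← add_div]
    congr 1
    have h2 := Finset.sum_range_succ (fun k => a k x) (N + 1)
    rw [Finset.sum_range_succ'] at h2
    linarith
  have hlim : ∀ x, ∃ l ∈ Set.Icc C⁻¹ C, Tendsto (fun N => H N x) (hyperfilter ℕ) (𝓝 l) := by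
    intro x
    obtain ⟨l, hl, hle⟩ := isCompact_Icc.ultrafilter_le_nhds
      ((hyperfilter ℕ).map fun N => H N x)
      (le_principal_iff.2 (Ultrafilter.mem_map.2 (univ_mem' fun N => hH N x)))
    exact ⟨l, hl, hle⟩
  choose h hh hht using hlim
  refine ⟨h, ?_, hh, fun x => ?_⟩
  · have hdist : ∀ m : ℕ, ∀ x y : ShiftSpace A, (∀ i < m + 1, x.1 i = y.1 i) →
        h x - h y ≤ C * (Real.exp (V / (1 - θ) * θ ^ (m + 1)) - 1) := by
      intro m x y hxy
      set E := Real.exp (V / (1 - θ) * θ ^ (m + 1)) with hE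
      have hE1 : 1 ≤ E := Real.one_le_exp
        (mul_nonneg (div_nonneg hV (sub_nonneg.2 hθ1.le)) (pow_nonneg hθ0.le _))
      have h1 : ∀ k, a k x ≤ E * a k y := by
        intro k
        have := ENNReal.toReal_mono (ENNReal.mul_ne_top ENNReal.ofReal_ne_top (htop k y))
          (transferIter_one_le_of_prefix hu hθ0 hθ1 hV k m hxy)
        rwa [ENNReal.toReal_mul, ENNReal.toReal_ofReal (Real.exp_pos _).le] at this
      have h2 : ∀ N, H N x ≤ E * H N y := by
        intro N
        change _ / _ ≤ E * (_ / _)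
        rw [← mul_div_assoc, Finset.mul_sum]
        exact div_le_div_of_nonneg_right (Finset.sum_le_sum fun k _ => h1 k) (hN N).le
      have h3 : h x ≤ E * h y :=
        le_of_tendsto_of_tendsto' (hht x) ((hht y).const_mul E) h2
      have h4 : (E - 1) * h y ≤ (E - 1) * C :=
        mul_le_mul_of_nonneg_left (hh y).2 (sub_nonneg.2 hE1)
      linarith
    have hsmall : Tendsto (fun m : ℕ => C * (Real.exp (V / (1 - θ) * θ ^ (m + 1)) - 1)) atTop
        (𝓝 0) := by
      have h1 : Tendsto (fun m : ℕ => θ ^ (m + 1)) atTop (𝓝 0) :=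
        (tendsto_add_atTop_iff_nat 1).2 (tendsto_pow_atTop_nhds_zero_of_lt_one hθ0.le hθ1)
      have h2 := (Real.continuous_exp.tendsto _).comp (h1.const_mul (V / (1 - θ)))
      have h3 := (h2.sub_const 1).const_mul C
      simpa using h3
    rw [continuous_iff_continuousAt]
    intro x
    rw [ContinuousAt, Metric.tendsto_nhds]
    intro ε hε
    obtain ⟨m, hm⟩ := (hsmall.eventually (gt_mem_nhds hε)).exists
    filter_upwards [prefix_mem_nhds x (m + 1)] with y hy
    rw [Real.dist_eq, abs_lt]
    have h1 := hdist m y x hy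
    have h2 := hdist m x y fun i hi => (hy i hi).symm
    constructor <;> linarith
  · have h1 : Tendsto (fun N => ∑' y : {y : ShiftSpace A // shift y = x},
        Real.exp (u y.1) * H N y.1) (hyperfilter ℕ)
        (𝓝 (∑' y : {y : ShiftSpace A // shift y = x}, Real.exp (u y.1) * h y.1)) :=
      tendsto_tsum_of_dominated_convergence ((hexp x).mul_right C)
        (fun y => (hht y.1).const_mul _) (Eventually.of_forall fun N y => hsum (hH N) x y)
    have h2 : Tendsto (fun N : ℕ => (a (N + 1) x - a 0 x) / (N + 1 : ℝ)) atTop (𝓝 0) := by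
      have h3 : Tendsto (fun N : ℕ => 1 / ((N : ℝ) + 1)) atTop (𝓝 0) :=
        tendsto_one_div_add_atTop_nhds_zero_nat
      have h4 := h3.const_mul C
      rw [mul_zero] at h4
      refine squeeze_zero_norm (fun N => ?_) h4
      rw [norm_div, Real.norm_of_nonneg (hN N).le, mul_one_div]
      refine div_le_div_of_nonneg_right ?_ (hN N).le
      rw [Real.norm_eq_abs, abs_le]
      have e1 := ha (N + 1) x
      have e2 := ha 0 x
      have e3 := inv_pos.2 hC
      constructor <;> linarith
    have h3 := (hht x).add (h2.mono_left (Nat.hyperfilter_le_atTop))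
    rw [add_zero] at h3
    exact tendsto_nhds_unique h1 (h3.congr fun N => (hHstep N x).symm)

/-! ### The transfer operator as a sum over preimages -/

theorem shift_cons {α : Type*} {A : α → α → Bool} (e : α) (x : ShiftSpace A)
    (h : A e (x.1 0) = true) : shift (cons e x h) = x :=
  rfl

theorem cons_shift {α : Type*} {A : α → α → Bool} (y : ShiftSpace A) :
    cons (y.1 0) (shift y) (y.2 0) = y :=
  Subtype.ext (funext fun j => by cases j <;> rfl)

theorem transferTerm_first_letter {α : Type*} {A : α → α → Bool} (f g : ShiftSpace A → ℂ)
    {x : ShiftSpace A} (y : {y : ShiftSpace A // shift y = x}) :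
    transferTerm f g (y.1.1 0) x = Complex.exp (f y.1) * g y.1 := by
  obtain ⟨y, rfl⟩ := y
  have h : A (y.1 0) ((shift y).1 0) = true := y.2 0
  rw [transferTerm, dif_pos h, cons_shift]

theorem transferTerm_eq_zero {α : Type*} {A : α → α → Bool} (f g : ShiftSpace A → ℂ)
    {x : ShiftSpace A} {e : α}
    (he : e ∉ Set.range fun y : {y : ShiftSpace A // shift y = x} => y.1.1 0) :
    transferTerm f g e x = 0 :=
  dif_neg fun h => he ⟨⟨cons e x h, shift_cons e x h⟩, rfl⟩

/-- A sum over letters of a function of the transfer terms is a sum over preimages. -/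
theorem tsum_transferTerm {α β : Type*} [AddCommMonoid β] [TopologicalSpace β]
    {A : α → α → Bool} (F : ℂ → β) (hF : F 0 = 0) (f g : ShiftSpace A → ℂ) (x : ShiftSpace A) :
    ∑' e, F (transferTerm f g e x)
      = ∑' y : {y : ShiftSpace A // shift y = x}, F (Complex.exp (f y.1) * g y.1) := by
  rw [← (injective_first_letter x).tsum_eq (f := fun e => F (transferTerm f g e x))]
  · exact tsum_congr fun y => by rw [transferTerm_first_letter]
  · intro e he
    by_contra h
    refine he ?_
    beta_reduce
    rw [transferTerm_eq_zero f g h, hF]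

theorem transferOperator_apply {α : Type*} [TopologicalSpace α] [DiscreteTopology α]
    {A : α → α → Bool} {f : ShiftSpace A → ℂ} (hf : Continuous f)
    (hu : IsSummable (fun x => (f x).re)) (g : ShiftSpace A →ᵇ ℂ) (x : ShiftSpace A) :
    transferOperator f hf hu g x
      = ∑' y : {y : ShiftSpace A // shift y = x}, Complex.exp (f y.1) * g y.1 :=
  tsum_transferTerm id rfl f g x

theorem summable_preimages {α : Type*} {A : α → α → Bool} {f g : ShiftSpace A → ℂ} {C : ℝ}
    (hu : IsSummable (fun x => (f x).re)) (hg : ∀ x, ‖g x‖ ≤ C) (x : ShiftSpace A) :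
    Summable fun y : {y : ShiftSpace A // shift y = x} => ‖Complex.exp (f y.1) * g y.1‖ := by
  have h := (Summable.of_nonneg_of_le (fun _ => norm_nonneg _)
    (fun e => norm_transferTerm_le hu hg e x)
    ((summable_letterWeight hu).mul_right C)).comp_injective (injective_first_letter x)
  exact h.congr fun y => by rw [Function.comp_apply, transferTerm_first_letter]

theorem continuous_tsum_norm_transferTerm {α : Type*} [TopologicalSpace α] [DiscreteTopology α]
    {A : α → α → Bool} {f g : ShiftSpace A → ℂ} {C : ℝ} (hf : Continuous f)
    (hu : IsSummable (fun x => (f x).re)) (hgc : Continuous g) (hg : ∀ x, ‖g x‖ ≤ C) :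
    Continuous fun x => ∑' y : {y : ShiftSpace A // shift y = x},
      ‖Complex.exp (f y.1) * g y.1‖ := by
  have h : Continuous fun x => ∑' e, ‖transferTerm f g e x‖ :=
    continuous_tsum (fun e => (continuous_transferTerm hf hgc e).norm)
      ((summable_letterWeight hu).mul_right C) fun e x => by
        rw [norm_norm]
        exact norm_transferTerm_le hu hg e x
  exact h.congr fun x => tsum_transferTerm norm norm_zero f g x

theorem IsHolder.exists_hasVariationBound {α : Type*} [TopologicalSpace α] {A : α → α → Bool}
    {θ : ℝ} (hθ0 : 0 < θ) {f : ShiftSpace A → ℂ} (hf : IsHolder θ f) :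
    ∃ V, 0 ≤ V ∧ HasVariationBound θ V fun x => (f x).re := by
  refine ⟨(holderNorm θ f).toReal, ENNReal.toReal_nonneg, fun n hn x y hxy => ?_⟩
  have hpow : 0 < θ ^ n := pow_pos hθ0 n
  have h1 : variation n f / ENNReal.ofReal (θ ^ n) ≤ holderNorm θ f :=
    le_iSup₂ (f := fun (n : ℕ) (_ : 1 ≤ n) => variation n f / ENNReal.ofReal (θ ^ n)) n hn
  have h2 : ENNReal.ofReal ‖f x - f y‖ ≤ variation n f :=
    le_iSup_of_le x (le_iSup_of_le y (le_iSup_of_le hxy le_rfl))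
  rw [ENNReal.div_le_iff (ENNReal.ofReal_pos.2 hpow).ne' ENNReal.ofReal_ne_top] at h1
  have h3 := ENNReal.toReal_mono
    (ENNReal.mul_ne_top hf.holderNorm_lt_top.ne ENNReal.ofReal_ne_top) (h2.trans h1)
  rw [ENNReal.toReal_ofReal (norm_nonneg _), ENNReal.toReal_mul,
    ENNReal.toReal_ofReal hpow.le] at h3
  calc (f x).re - (f y).re = (f x - f y).re := (Complex.sub_re _ _).symm
    _ ≤ ‖f x - f y‖ := Complex.re_le_norm _
    _ ≤ _ := h3

/-! ### Phases -/

/-- On a shift space every continuous nowhere vanishing complex function has a continuous argument: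
each point has a shortest prefix on whose cylinder the values stay in the slit plane or in its
negative, and on that cylinder one branch of the argument can be used. -/
theorem exists_continuous_arg {α : Type*} [TopologicalSpace α] [DiscreteTopology α]
    {A : α → α → Bool} {g : ShiftSpace A → ℂ} (hg : Continuous g) (h0 : ∀ x, g x ≠ 0) :
    ∃ η : C(ShiftSpace A, ℝ), ∀ x, g x = ‖g x‖ * Complex.exp (η x * Complex.I) := by
  classical
  let S : ℕ → ShiftSpace A → Prop := fun n x =>
    ∀ y : ShiftSpace A, (∀ i < n, y.1 i = x.1 i) → g y ∈ Complex.slitPlane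
  let T : ℕ → ShiftSpace A → Prop := fun n x =>
    ∀ y : ShiftSpace A, (∀ i < n, y.1 i = x.1 i) → -g y ∈ Complex.slitPlane
  have hST : ∀ x, ∃ n, S n x ∨ T n x := by
    intro x
    rcases Complex.mem_slitPlane_or_neg_mem_slitPlane (h0 x) with h | h
    · obtain ⟨n, hn⟩ := exists_prefix_subset_of_mem_nhds
        (hg.continuousAt.preimage_mem_nhds (Complex.isOpen_slitPlane.mem_nhds h))
      exact ⟨n, Or.inl hn⟩
    · obtain ⟨n, hn⟩ := exists_prefix_subset_of_mem_nhds
        (hg.neg.continuousAt.preimage_mem_nhds (Complex.isOpen_slitPlane.mem_nhds h))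
      exact ⟨n, Or.inr hn⟩
  have hScongr : ∀ {n} {x y : ShiftSpace A}, (∀ i < n, y.1 i = x.1 i) → (S n y ↔ S n x) :=
    fun hxy => forall_congr' fun _ => imp_congr_left
      (forall₂_congr fun i hi => by rw [hxy i hi])
  have hTcongr : ∀ {n} {x y : ShiftSpace A}, (∀ i < n, y.1 i = x.1 i) → (T n y ↔ T n x) :=
    fun hxy => forall_congr' fun _ => imp_congr_left
      (forall₂_congr fun i hi => by rw [hxy i hi])
  let N : ShiftSpace A → ℕ := fun x => Nat.find (hST x)
  have hN : ∀ {x y : ShiftSpace A}, (∀ i < N x, y.1 i = x.1 i) → N y = N x := by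
    intro x y hxy
    refine (Nat.find_eq_iff _).2 ⟨?_, fun m hm => ?_⟩
    · rw [hScongr hxy, hTcongr hxy]
      exact Nat.find_spec (hST x)
    · have hxy' : ∀ i < m, y.1 i = x.1 i := fun i hi => hxy i (hi.trans hm)
      rw [hScongr hxy', hTcongr hxy']
      exact Nat.find_min (hST x) hm
  let η : ShiftSpace A → ℝ := fun x =>
    if S (N x) x then (g x).arg else (-g x).arg + Real.pi
  refine ⟨⟨η, continuous_iff_continuousAt.2 fun x => ?_⟩, fun x => ?_⟩
  · by_cases hS : S (N x) x
    · have h1 : ContinuousAt (fun y => (g y).arg) x :=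
        (Complex.continuousAt_arg (hS x fun i _ => rfl)).comp hg.continuousAt
      refine h1.congr ?_
      filter_upwards [prefix_mem_nhds x (N x)] with y hy
      exact (if_pos (by rw [hN hy]; exact (hScongr hy).2 hS)).symm
    · have hT : T (N x) x := (Nat.find_spec (hST x)).resolve_left hS
      have h1 : ContinuousAt (fun y => (-g y).arg + Real.pi) x :=
        ((Complex.continuousAt_arg (hT x fun i _ => rfl)).comp (f := fun y => -g y)
          hg.neg.continuousAt).add continuousAt_const
      refine h1.congr ?_
      filter_upwards [prefix_mem_nhds x (N x)] with y hy
      exact (if_neg (by rw [hN hy]; exact fun h => hS ((hScongr hy).1 h))).symm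
  · change g x = ‖g x‖ * Complex.exp (((if S (N x) x then (g x).arg
      else (-g x).arg + Real.pi : ℝ) : ℂ) * Complex.I)
    split_ifs
    · exact (Complex.norm_mul_exp_arg_mul_I _).symm
    · have h := Complex.norm_mul_exp_arg_mul_I (-g x)
      rw [norm_neg] at h
      rw [Complex.ofReal_add, add_mul, Complex.exp_add, Complex.exp_pi_mul_I, mul_neg_one, mul_neg,
        h, neg_neg]

/-- Equality in the triangle inequality for a series: all terms point in the direction of the
sum. -/
theorem eq_norm_mul_of_tsum_eq {ι : Type*} {t : ι → ℂ} (ht : Summable fun i => ‖t i‖) {d : ℂ}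
    (hd : ‖d‖ = 1) (h : ∑' i, t i = ((∑' i, ‖t i‖ : ℝ) : ℂ) * d) (i : ι) : t i = ‖t i‖ * d := by
  have hdd : d * starRingEnd ℂ d = 1 := by
    rw [Complex.mul_conj, Complex.normSq_eq_norm_sq, hd]
    simp
  have hnorm : ∀ i, ‖starRingEnd ℂ d * t i‖ = ‖t i‖ := fun i => by
    rw [norm_mul, RCLike.norm_conj, hd, one_mul]
  have h1 : HasSum (fun i => (starRingEnd ℂ d * t i).re) (∑' i, ‖t i‖) := by
    have h2 := Complex.hasSum_re ((ht.of_norm.hasSum).mul_left (starRingEnd ℂ d))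
    rwa [h, mul_left_comm, mul_comm (starRingEnd ℂ d), hdd, mul_one, Complex.ofReal_re] at h2
  have h2 : HasSum (fun i => ‖t i‖ - (starRingEnd ℂ d * t i).re) 0 := by
    have := ht.hasSum.sub h1
    rwa [sub_self] at this
  have h3 := (hasSum_zero_iff_of_nonneg fun i => by
    rw [sub_nonneg, ← hnorm i]
    exact Complex.re_le_norm _).1 h2
  have h4 : (starRingEnd ℂ d * t i).re = ‖starRingEnd ℂ d * t i‖ := by
    rw [hnorm]
    exact (sub_eq_zero.1 (congrFun h3 i)).symm
  have h5 : starRingEnd ℂ d * t i = (‖t i‖ : ℂ) := by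
    have h6 : (starRingEnd ℂ d * t i).im = 0 :=
      Complex.abs_re_eq_norm.1 (by rw [h4, abs_of_nonneg (norm_nonneg _)])
    rw [hnorm] at h4
    exact Complex.ext (by rw [h4, Complex.ofReal_re]) (by rw [h6, Complex.ofReal_im])
  calc t i = d * starRingEnd ℂ d * t i := by rw [hdd, one_mul]
    _ = _ := by rw [mul_assoc, h5, mul_comm]

/-! ### Eigenfunctions and cohomology -/

/-- A positive eigenfunction twisted by the phase `exp (-i ζ)` is an eigenfunction for the twisted
eigenvalue. -/
theorem hasEigenvalue_of_cohomologous {α : Type*} [TopologicalSpace α] [DiscreteTopology α]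
    {A : α → α → Bool} [Nonempty (ShiftSpace A)] {f : ShiftSpace A → ℂ} (hf : Continuous f)
    (hu : IsSummable (fun x => (f x).re)) {P a C : ℝ} {h : ShiftSpace A → ℝ} (hc : Continuous h)
    (hpos : ∀ x, 0 < h x) (hC : ∀ x, h x ≤ C)
    (heig : ∀ x, ∑' y : {y : ShiftSpace A // shift y = x},
      Real.exp ((f y.1).re - P) * h y.1 = h x)
    (ζ : C(ShiftSpace A, ℝ))
    (hζ : ∀ x, ∃ k : ℤ, (f x).im - a + ζ (shift x) - ζ x = 2 * Real.pi * (k : ℝ)) :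
    Module.End.HasEigenvalue (transferOperator f hf hu : Module.End ℂ (ShiftSpace A →ᵇ ℂ))
      (Complex.exp (Complex.I * (a : ℂ) + (P : ℂ))) := by
  let g : ShiftSpace A →ᵇ ℂ := BoundedContinuousFunction.ofNormedAddCommGroup
    (fun x => (h x : ℂ) * Complex.exp (((-ζ x : ℝ) : ℂ) * Complex.I))
    ((Complex.continuous_ofReal.comp hc).mul (Complex.continuous_exp.comp
      ((Complex.continuous_ofReal.comp ζ.continuous.neg).mul continuous_const))) C
    (fun x => by
      rw [norm_mul, Complex.norm_exp_ofReal_mul_I, mul_one, Complex.norm_real,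
        Real.norm_of_nonneg (hpos x).le]
      exact hC x)
  have hg : ∀ x, g x = (h x : ℂ) * Complex.exp (((-ζ x : ℝ) : ℂ) * Complex.I) := fun x => rfl
  refine Module.End.hasEigenvalue_of_hasEigenvector (x := g)
    (Module.End.hasEigenvector_iff.2 ⟨Module.End.mem_eigenspace_iff.2 ?_, fun h0 => ?_⟩)
  · ext x
    change transferOperator f hf hu g x = Complex.exp (Complex.I * (a : ℂ) + (P : ℂ)) * g x
    rw [transferOperator_apply]
    have hterm : ∀ y : {y : ShiftSpace A // shift y = x}, Complex.exp (f y.1) * g y.1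
        = ((Real.exp ((f y.1).re - P) * h y.1 : ℝ) : ℂ)
          * (Complex.exp (Complex.I * (a : ℂ) + (P : ℂ))
            * Complex.exp (((-ζ x : ℝ) : ℂ) * Complex.I)) := by
      rintro ⟨y, rfl⟩
      obtain ⟨k, hk⟩ := hζ y
      have him : (((f y).im : ℝ) : ℂ) = a - ζ (shift y) + ζ y + 2 * Real.pi * k := by
        have : (f y).im = a - ζ (shift y) + ζ y + 2 * Real.pi * k := by linarith
        rw [this]
        push_cast
        ring
      have hfy : f y = (f y).re + (a - ζ (shift y) + ζ y + 2 * Real.pi * k) * Complex.I := by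
        rw [← him, Complex.re_add_im]
      rw [hg]
      change Complex.exp (f y) * ((h y : ℂ) * _) = _
      rw [Complex.ofReal_mul, Complex.ofReal_exp, mul_left_comm, mul_comm _ (h y : ℂ),
        mul_assoc, ← Complex.exp_add, ← Complex.exp_add, ← Complex.exp_add]
      congr 1
      refine Complex.exp_eq_exp_iff_exists_int.2 ⟨k, ?_⟩
      conv_lhs => rw [hfy]
      push_cast
      ring
    rw [tsum_congr hterm, tsum_mul_right, ← Complex.ofReal_tsum, heig x, hg]
    ring
  · let x₀ : ShiftSpace A := Classical.arbitrary _
    have h1 : g x₀ = 0 := by rw [h0]; rfl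
    rw [hg] at h1
    exact mul_ne_zero (Complex.ofReal_ne_zero.2 (hpos x₀).ne') (Complex.exp_ne_zero _) h1

/-- The modulus of an eigenfunction with an eigenvalue of modulus `exp P` vanishes nowhere and is
itself fixed by the normalised operator of the real part. -/
theorem norm_eigenfunction {α : Type*} [TopologicalSpace α] [DiscreteTopology α]
    {A : α → α → Bool} [Nonempty (ShiftSpace A)] {θ V : ℝ} {f : ShiftSpace A → ℂ}
    (hA : FinitelyIrreducible A) (hf : Continuous f) (hu : IsSummable (fun x => (f x).re))
    {P C : ℝ} (hv : HasVariationBound θ V fun x => (f x).re - P) (hθ0 : 0 < θ) (hθ1 : θ < 1)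
    (hV : 0 ≤ V) (hC : 0 < C)
    (hlow : ∀ n x,
      ENNReal.ofReal C⁻¹ ≤ transferIter (fun y => (f y).re - P) n (fun _ => 1) x)
    (hupp : ∀ n x,
      transferIter (fun y => (f y).re - P) n (fun _ => 1) x ≤ ENNReal.ofReal C)
    {l : ℂ} (hl : ‖l‖ = Real.exp P) {g : ShiftSpace A →ᵇ ℂ} (hg0 : g ≠ 0)
    (hg : transferOperator f hf hu g = l • g) :
    (∀ x, g x ≠ 0) ∧ ∀ x, ∑' y : {y : ShiftSpace A // shift y = x},
      ‖Complex.exp (f y.1) * g y.1‖ = Real.exp P * ‖g x‖ := by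
  let G : ShiftSpace A → ℝ := fun x =>
    ∑' y : {y : ShiftSpace A // shift y = x}, ‖Complex.exp (f y.1) * g y.1‖
  have hGc : Continuous G :=
    continuous_tsum_norm_transferTerm hf hu g.continuous g.norm_coe_le_norm
  let w : ShiftSpace A → ℝ≥0∞ := fun x => ENNReal.ofReal ‖g x‖
  let D : ShiftSpace A → ℝ := fun x => Real.exp (-P) * G x - ‖g x‖
  have hDc : Continuous D := (hGc.const_mul _).sub g.continuous.norm
  have hexp : Real.exp (-P) * Real.exp P = 1 := by
    rw [← Real.exp_add, neg_add_cancel, Real.exp_zero]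
  have hD0 : ∀ x, 0 ≤ D x := by
    intro x
    have h1 : Real.exp P * ‖g x‖ ≤ G x := by
      have h2 : transferOperator f hf hu g x = l * g x := by rw [hg]; rfl
      rw [transferOperator_apply] at h2
      rw [← hl, ← norm_mul, ← h2]
      exact norm_tsum_le_tsum_norm (summable_preimages hu g.norm_coe_le_norm x)
    have h2 := mul_le_mul_of_nonneg_left h1 (Real.exp_pos (-P)).le
    rw [← mul_assoc, hexp, one_mul] at h2
    exact sub_nonneg.2 h2
  have hw : ∀ x, transferIter (fun y => (f y).re - P) 1 w x
      = w x + ENNReal.ofReal (D x) := by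
    intro x
    rw [← ENNReal.ofReal_add (norm_nonneg _) (hD0 x), add_sub_cancel, transferIter_one_eq,
      ENNReal.ofReal_mul (Real.exp_pos _).le, ENNReal.ofReal_tsum_of_nonneg
      (fun _ => norm_nonneg _) (summable_preimages hu g.norm_coe_le_norm x),
      ← ENNReal.tsum_mul_left]
    refine tsum_congr fun y => ?_
    change ENNReal.ofReal (Real.exp ((f y.1).re - P)) * ENNReal.ofReal ‖g y.1‖ = _
    rw [← ENNReal.ofReal_mul (Real.exp_pos _).le, ← ENNReal.ofReal_mul (Real.exp_pos _).le,
      norm_mul, Complex.norm_exp, ← mul_assoc, ← Real.exp_add, neg_add_eq_sub]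
  have hD : ∀ x, D x = 0 := by
    by_contra! h
    obtain ⟨x₀, hx₀⟩ := h
    have hpos : 0 < D x₀ := (hD0 x₀).lt_of_ne' hx₀
    obtain ⟨n, hn⟩ := exists_prefix_subset_of_mem_nhds
      (hDc.continuousAt.eventually (lt_mem_nhds (half_lt_self hpos)))
    have h1 := eq_zero_of_add_le_transferIter hA hv hθ0 hθ1 hV
      (ENNReal.ofReal_pos.2 (inv_pos.2 hC)).ne' ENNReal.ofReal_ne_top
      (ENNReal.ofReal_ne_top (r := ‖g‖)) hlow hupp (w := w)
      (D := fun x => ENNReal.ofReal (D x))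
      (fun x => ENNReal.ofReal_le_ofReal (g.norm_coe_le_norm x)) (fun x => (hw x).ge) x₀ n
      (δ := ENNReal.ofReal (D x₀ / 2)) (fun z hz => ENNReal.ofReal_le_ofReal (hn z hz).le)
    exact (ENNReal.ofReal_pos.2 (half_pos hpos)).ne' h1
  refine ⟨fun x hx => ?_, fun x => ?_⟩
  · have hfix : ∀ k, transferIter (fun y => (f y).re - P) k w = w := by
      intro k
      induction k with
      | zero => exact funext fun y => transferIter_zero _ _ _
      | succ k ih =>
        funext y
        rw [transferIter_add]
        have : transferIter (fun y => (f y).re - P) 1 w = w :=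
          funext fun z => by rw [hw, hD, ENNReal.ofReal_zero, add_zero]
        rw [this, ih]
    obtain ⟨x₀, hx₀⟩ : ∃ x₀, g x₀ ≠ 0 := by
      by_contra! h
      exact hg0 (BoundedContinuousFunction.ext h)
    have hpos : 0 < ‖g x₀‖ := norm_pos_iff.2 hx₀
    obtain ⟨n, hn⟩ := exists_prefix_subset_of_mem_nhds
      (g.continuous.norm.continuousAt.eventually (lt_mem_nhds (half_lt_self hpos)))
    obtain ⟨M, c, hc, hspread⟩ := exists_le_transferIter hA hv hθ0 hθ1 hV x₀ n
    obtain ⟨k, -, hk⟩ := hspread w (ENNReal.ofReal (‖g x₀‖ / 2))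
      (fun z hz => ENNReal.ofReal_le_ofReal (hn z hz).le) x
    have hwx : w x = 0 := by
      change ENNReal.ofReal ‖g x‖ = 0
      rw [hx, norm_zero, ENNReal.ofReal_zero]
    rw [hfix, hwx, nonpos_iff_eq_zero] at hk
    exact mul_ne_zero hc (ENNReal.ofReal_pos.2 (half_pos hpos)).ne' hk
  · have h1 : Real.exp (-P) * G x = ‖g x‖ := sub_eq_zero.1 (hD x)
    change G x = _
    rw [← h1, ← mul_assoc, mul_comm (Real.exp P), hexp, one_mul]

/-- If `g` is an eigenfunction and the triangle inequality is an equality for every preimage sum,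
then a continuous argument of `g` solves the cohomological equation modulo `2 π`. -/
theorem exists_cohomologous_of_eigenfunction {α : Type*} [TopologicalSpace α] [DiscreteTopology α]
    {A : α → α → Bool} {f : ShiftSpace A → ℂ} (hf : Continuous f)
    (hu : IsSummable (fun x => (f x).re)) {P a : ℝ} {g : ShiftSpace A →ᵇ ℂ}
    (hg : transferOperator f hf hu g = Complex.exp (Complex.I * (a : ℂ) + (P : ℂ)) • g)
    (hg0 : ∀ x, g x ≠ 0)
    (hnorm : ∀ x, ∑' y : {y : ShiftSpace A // shift y = x},
      ‖Complex.exp (f y.1) * g y.1‖ = Real.exp P * ‖g x‖) :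
    ∃ ζ : C(ShiftSpace A, ℝ), ∀ x, ∃ k : ℤ,
      (f x).im - a + ζ (shift x) - ζ x = 2 * Real.pi * (k : ℝ) := by
  obtain ⟨η, hη⟩ := exists_continuous_arg g.continuous hg0
  refine ⟨-η, fun x => ?_⟩
  have hsum : ∑' y : {y : ShiftSpace A // shift y = shift x}, Complex.exp (f y.1) * g y.1
      = ((∑' y : {y : ShiftSpace A // shift y = shift x},
          ‖Complex.exp (f y.1) * g y.1‖ : ℝ) : ℂ)
        * Complex.exp ((a + η (shift x) : ℝ) * Complex.I) := by
    rw [← transferOperator_apply hf hu g (shift x), hg, hnorm]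
    change Complex.exp (Complex.I * (a : ℂ) + (P : ℂ)) * g (shift x) = _
    conv_lhs => rw [hη (shift x)]
    rw [mul_left_comm, ← Complex.exp_add, Complex.ofReal_mul, Complex.ofReal_exp,
      mul_comm (Complex.exp (P : ℂ)), mul_assoc, ← Complex.exp_add]
    congr 2
    push_cast
    ring
  have hterm := eq_norm_mul_of_tsum_eq (summable_preimages hu g.norm_coe_le_norm (shift x))
    (Complex.norm_exp_ofReal_mul_I _) hsum ⟨x, rfl⟩
  have hne : (‖g x‖ : ℂ) ≠ 0 := Complex.ofReal_ne_zero.2 (norm_ne_zero_iff.2 (hg0 x))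
  have h1 : Complex.exp (f x + η x * Complex.I)
      = Complex.exp ((f x).re + (a + η (shift x) : ℝ) * Complex.I) := by
    refine mul_left_cancel₀ hne ?_
    rw [Complex.exp_add, Complex.exp_add, mul_left_comm, ← hη x, hterm, norm_mul,
      Complex.norm_exp]
    push_cast
    ring
  obtain ⟨k, hk⟩ := Complex.exp_eq_exp_iff_exists_int.1 h1
  refine ⟨k, ?_⟩
  have h2 := congrArg Complex.im hk
  simp at h2
  change (f x).im - a + -η (shift x) - -η x = _
  linarith

end

end MarkovShift

theorem mainTheorem2 {α : Type*} [Countable α] [Nonempty α] [TopologicalSpace α]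
    [DiscreteTopology α] (A : α → α → Bool) (hA : MarkovShift.FinitelyIrreducible A)
    (θ : ℝ) (hθ0 : 0 < θ) (hθ1 : θ < 1)
    (f : MarkovShift.ShiftSpace A → ℂ) (hf : MarkovShift.IsHolder θ f)
    (hu : MarkovShift.IsSummable (fun x => (f x).re)) :
    ∃ P : ℝ, MarkovShift.HasPressure (fun x => (f x).re) P ∧
      ∀ a : ℝ, 0 ≤ a → a < 2 * Real.pi →
        (Module.End.HasEigenvalue
            (MarkovShift.transferOperator f hf.continuous hu :
              Module.End ℂ (MarkovShift.ShiftSpace A →ᵇ ℂ))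
            (Complex.exp (Complex.I * (a : ℂ) + (P : ℂ))) ↔
          ∃ ζ : C(MarkovShift.ShiftSpace A, ℝ), ∀ x : MarkovShift.ShiftSpace A, ∃ k : ℤ,
            (f x).im - a + ζ (MarkovShift.shift x) - ζ x = 2 * Real.pi * (k : ℝ)) := by
  have hne : Nonempty (MarkovShift.ShiftSpace A) := by
    obtain ⟨Λ, -, -, h⟩ := hA
    obtain ⟨w, -, h0 | ⟨x, -⟩⟩ := h (Classical.arbitrary α) (Classical.arbitrary α)
    · exact absurd h0 (List.cons_ne_nil _ _)
    · exact ⟨x⟩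
  obtain ⟨V, hV, hvar⟩ := hf.exists_hasVariationBound hθ0
  obtain ⟨P, hP, C, hC, hbd⟩ := MarkovShift.exists_hasPressure hA hvar hθ0 hθ1 hV hu
  have hvarP : MarkovShift.HasVariationBound θ V fun x => (f x).re - P := fun n hn x y hxy => by
    rw [sub_sub_sub_cancel_right]
    exact hvar n hn x y hxy
  refine ⟨P, hP, fun a _ _ => ⟨fun h => ?_, fun ⟨ζ, hζ⟩ => ?_⟩⟩
  · obtain ⟨g, hg⟩ := h.exists_hasEigenvector
    have hgeq := Module.End.mem_eigenspace_iff.1 hg.1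
    have hl : ‖Complex.exp (Complex.I * (a : ℂ) + (P : ℂ))‖ = Real.exp P := by
      rw [Complex.norm_exp]
      simp
    obtain ⟨hg0, hnorm⟩ := MarkovShift.norm_eigenfunction hA hf.continuous hu hvarP hθ0 hθ1 hV hC
      (fun n x => (hbd n x).1) (fun n x => (hbd n x).2) hl hg.2 hgeq
    exact MarkovShift.exists_cohomologous_of_eigenfunction hf.continuous hu hgeq hg0 hnorm
  · obtain ⟨h, hc, hh, heig⟩ := MarkovShift.exists_eigenfunction hvarP hθ0 hθ1 hV hC
      (fun n x => (hbd n x).1) (fun n x => (hbd n x).2)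
    exact MarkovShift.hasEigenvalue_of_cohomologous hf.continuous hu hc
      (fun x => (inv_pos.2 hC).trans_le (hh x).1) (fun x => (hh x).2) heig ζ hζ
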